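/- Let $\mathfrak p_1<\mathfrak p_2<\cdots$ be the sequence of primes and, for $m,n\in\mathbb N=\{1,2,\dots\}$, let $$N_\infty(\le m,n)=\Big\{\mathfrak p^\alpha=\prod_{j=1}^n\mathfrak p_j^{\alpha_j}:\ \alpha\in\mathbb N_0^n,\ \max_j\alpha_j\le m\Big\}.$$ For the frequency $\omega=(\log k)_{k\in\mathbb N}$ and a finite set $J\subset\mathbb N$, let $\mathcal H_\infty^J(\omega)$ be the complex Banach space of all Dirichlet polynomials $D(s)=\sum_{k\in J}a_kk^{-s}$ $(a_k\in\mathbb C)$ with norm $\|D\|_\infty=\sup_{t\in\mathbb R}|D(it)|$. For a closed subspace $X$ of a complex Banach space $Y$ put $\lambda(X,Y)=\inf\{\|P\|: P\in\mathcal L(Y,X),\ P|_X=\mathrm{id}_X\}$ ($\inf\emptyset=\infty$), and let the projection constant $\lambda(X)$ of a complex Banach space $X$ be the supremum of $\lambda(I(X),Y)$ over all complex Banach spaces $Y$ and all linear isometric embeddings $I:X\to Y$ whose range is complemented in $Y$. Then the projection constants $\lambda\big(\mathcal H_\infty^{N_\infty(\le m,n)}(\omega)\big)$ are finite and satisfy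 $$\lambda\big(\mathcal H_\infty^{N_\infty(\le m,n)}(\omega)\big)\sim_{C^n}(1+\log m)^n,$$ that is, there is an absolute constant $C>0$ such that for all $m,n\in\mathbb N$ $$C^{-n}(1+\log m)^n\le\lambda\big(\mathcal H_\infty^{N_\infty(\le m,n)}(\omega)\big)\le C^n(1+\log m)^n .$$ Moreover, for each fixed $n\in\mathbb N$, $$\lim_{m\to\infty}\frac{\lambda\big(\mathcal H_\infty^{N_\infty(\le m,n)}(\omega)\big)}{\log^n m}=\Big(\frac4{\pi^2}\Big)^n .$$ -/

import Mathlib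

open Filter Topology
open scoped ENNReal BoundedContinuousFunction

universe u

/-- The relative projection constant `inf {‖P‖ : P ∈ L(Y, X), P|_X = id_X}` of a subspace `X` of a
complex normed space `Y`, with value `∞` when there is no bounded projection of `Y` onto `X`. -/
noncomputable def relProjConst {Y : Type u} [NormedAddCommGroup Y] [NormedSpace ℂ Y]
    (X : Submodule ℂ Y) : ℝ≥0∞ :=
  ⨅ (P : Y →L[ℂ] X) (_ : ∀ x : X, P (x : Y) = x), ‖P‖ₑ

/-- The absolute projection constant of a complex Banach space `X`: the supremum of the relative
projection constants of `I(X)` in `Y`, over all complex Banach spaces `Y` and all linear isometric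
embeddings `I : X → Y` whose range is complemented in `Y`. (The universe of `X` is large enough for
the supremum: it contains `ℓ_∞(S)` with `S` the unit ball of the dual of `X`.) -/
noncomputable def projConst (X : Type u) [NormedAddCommGroup X] [NormedSpace ℂ X] : ℝ≥0∞ :=
  ⨆ (Y : Type u) (_ : NormedAddCommGroup Y) (_ : NormedSpace ℂ Y) (_ : CompleteSpace Y)
    (I : X →ₗᵢ[ℂ] Y) (_ : (LinearMap.range I.toLinearMap).ClosedComplemented),
      relProjConst (LinearMap.range I.toLinearMap)

/-- The complex vector space of all `ω`-Dirichlet polynomials `D(s) = ∑_{n ∈ J} a_n e^{-ω_n s}`,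
`s ∈ ℂ`, supported on the finite index set `J`. -/
def dirichletPoly (ω : ℕ → ℝ) (J : Finset ℕ) : Submodule ℂ (ℂ → ℂ) where
  carrier := {D | ∃ a : ℕ → ℂ, ∀ s : ℂ, D s = ∑ n ∈ J, a n * Complex.exp (-(ω n : ℂ) * s)}
  zero_mem' := ⟨0, fun s => by simp⟩
  add_mem' := by
    rintro D E ⟨a, ha⟩ ⟨b, hb⟩
    exact ⟨a + b, fun s => by simp [ha, hb, add_mul, Finset.sum_add_distrib]⟩
  smul_mem' := by
    rintro c D ⟨a, ha⟩
    exact ⟨c • a, fun s => by simp [ha, Finset.mul_sum, mul_assoc]⟩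

/-- The space `H_∞^J(ω)`: the vector space `dirichletPoly ω J`, as a type of its own so that it can
carry the norm `‖D‖_∞ = sup_{t ∈ ℝ} |D(it)|` defined below. -/
def HInf (ω : ℕ → ℝ) (J : Finset ℕ) : Type := dirichletPoly ω J

namespace HInf

variable {ω : ℕ → ℝ} {J : Finset ℕ}

instance instAddCommGroup : AddCommGroup (HInf ω J) :=
  inferInstanceAs (AddCommGroup (dirichletPoly ω J))

instance instModule : Module ℂ (HInf ω J) :=
  inferInstanceAs (Module ℂ (dirichletPoly ω J))

/-- The function `D : ℂ → ℂ` underlying an element of `H_∞^J(ω)`. -/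
def toFun (D : HInf ω J) : ℂ → ℂ := Subtype.val (p := (· ∈ dirichletPoly ω J)) D

theorem exists_coeff (D : HInf ω J) :
    ∃ a : ℕ → ℂ, ∀ s : ℂ, D.toFun s = ∑ n ∈ J, a n * Complex.exp (-(ω n : ℂ) * s) :=
  Subtype.property (p := (· ∈ dirichletPoly ω J)) D

theorem differentiable_toFun (D : HInf ω J) : Differentiable ℂ D.toFun := by
  obtain ⟨a, ha⟩ := D.exists_coeff
  rw [funext ha]
  fun_prop

theorem exists_bound (D : HInf ω J) :
    ∃ C : ℝ, ∀ t : ℝ, ‖D.toFun ((t : ℂ) * Complex.I)‖ ≤ C := by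
  obtain ⟨a, ha⟩ := D.exists_coeff
  refine ⟨∑ n ∈ J, ‖a n‖, fun t => ?_⟩
  rw [ha]
  refine (norm_sum_le _ _).trans (Finset.sum_le_sum fun n _ => ?_)
  have : ‖Complex.exp (-(ω n : ℂ) * ((t : ℂ) * Complex.I))‖ = 1 := by
    rw [Complex.norm_exp]; simp
  rw [norm_mul, this, mul_one]

/-- The restriction `t ↦ D(it)` of a Dirichlet polynomial to the imaginary axis, as a bounded
continuous function on `ℝ`. -/
noncomputable def restrictImag : HInf ω J →ₗ[ℂ] (ℝ →ᵇ ℂ) where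
  toFun D := BoundedContinuousFunction.ofNormedAddCommGroup
    (fun t : ℝ => D.toFun ((t : ℂ) * Complex.I))
    (D.differentiable_toFun.continuous.comp (by fun_prop))
    D.exists_bound.choose D.exists_bound.choose_spec
  map_add' _ _ := by ext; rfl
  map_smul' _ _ := by ext; rfl

/-- A Dirichlet polynomial is determined by its values on the imaginary axis. -/
theorem restrictImag_injective : Function.Injective (restrictImag : HInf ω J →ₗ[ℂ] (ℝ →ᵇ ℂ)) := by
  intro D E h
  have hval : ∀ t : ℝ, D.toFun ((t : ℂ) * Complex.I) = E.toFun ((t : ℂ) * Complex.I) :=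
    fun t => DFunLike.congr_fun h t
  have hfreq : ∃ᶠ z in 𝓝[≠] (0 : ℂ), D.toFun z = E.toFun z := by
    have ht : Tendsto (fun t : ℝ => (t : ℂ) * Complex.I) (𝓝[≠] 0) (𝓝[≠] 0) := by
      refine tendsto_nhdsWithin_iff.2 ⟨?_, ?_⟩
      · refine Tendsto.mono_left ?_ nhdsWithin_le_nhds
        have : Continuous fun t : ℝ => (t : ℂ) * Complex.I := by fun_prop
        simpa using this.tendsto 0
      · filter_upwards [self_mem_nhdsWithin] with t ht
        simpa using ht
    exact ht.frequently (Frequently.of_forall hval)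
  have hD : AnalyticOnNhd ℂ D.toFun Set.univ :=
    D.differentiable_toFun.differentiableOn.analyticOnNhd isOpen_univ
  have hE : AnalyticOnNhd ℂ E.toFun Set.univ :=
    E.differentiable_toFun.differentiableOn.analyticOnNhd isOpen_univ
  exact Subtype.ext (AnalyticOnNhd.eq_of_frequently_eq hD hE hfreq)

/-- The norm `‖D‖_∞ = sup_{t ∈ ℝ} |D(it)|` on `H_∞^J(ω)`. -/
noncomputable instance instNormedAddCommGroup : NormedAddCommGroup (HInf ω J) :=
  NormedAddCommGroup.induced (HInf ω J) (ℝ →ᵇ ℂ) restrictImag restrictImag_injective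

noncomputable instance instNormedSpace : NormedSpace ℂ (HInf ω J) :=
  NormedSpace.induced ℂ (HInf ω J) (ℝ →ᵇ ℂ) restrictImag

theorem norm_eq_iSup (D : HInf ω J) :
    ‖D‖ = ⨆ t : ℝ, ‖D.toFun ((t : ℂ) * Complex.I)‖ :=
  BoundedContinuousFunction.norm_eq_iSup_norm (restrictImag D)

end HInf

/-- The frequency `ω = (log n)_{n ≥ 1}` of ordinary Dirichlet polynomials. -/
noncomputable def logFreq : ℕ → ℝ := fun n => Real.log n

/-- The set of multi-indices `α ∈ ℕ₀ⁿ` with `max_j α_j ≤ m`. -/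
def multiIndexLe (m n : ℕ) : Finset (Fin n → ℕ) :=
  Fintype.piFinset fun _ : Fin n => Finset.Iic m

/-- The set of all positive integers `𝔭^α = ∏_j 𝔭_j^{α_j}` with `α ∈ ℕ₀ⁿ` and `max_j α_j ≤ m`, where
`𝔭_1 < 𝔭_2 < ⋯` is the sequence of all primes (numbered from `0` in `Nat.nth Nat.Prime`). -/
noncomputable def NInf (m n : ℕ) : Finset ℕ :=
  (multiIndexLe m n).image fun α => ∏ j : Fin n, Nat.nth Nat.Prime (j : ℕ) ^ α j

/-! The projection constant is computed exactly: it equals `lebesgueConst m ^ n` (`projConst_HInf`),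
after which only the growth of the Lebesgue constants is at stake. By unique factorization, the
substitution `z_j = 𝔭_j^{-it}` turns the Dirichlet polynomials into polynomials on the `n`-torus of
degree at most `m` in each variable, with the sup norm over the torus. On that space the product of
`n` Dirichlet kernels reproduces by convolution.

Upper bound (`HInf.exists_projection_norm_le`): evaluation at a torus point has norm at most one
(`norm_eval_torus_le`), hence extends by Hahn–Banach to any superspace `Y`. Convolving these
extended values with the kernel over a grid of roots of unity projects `Y` onto the space. The norm
is at most the `n`-th power of a Riemann sum for the Lebesgue constant.

Lower bound (`HInf.pow_norm_sum_le_of_projection`): let `P` be any projection of the bounded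
continuous functions on the line onto the space. The mean over all translations of the conjugates of
`P` acts on characters as the Fourier projection onto the box of multi-indices. It is tested on
products of trigonometric polynomials close to the sign of the Dirichlet kernel
(`exists_trigPoly_approx`).

Asymptotics: up to a bounded error, the Lebesgue constant is `2/π` times the integral of `|sinc|`
over `[0, (m+1)π/2]`. Each interval of length `π` contributes `2/π` times a term of the harmonic
series, whence `4/π²`. -/

/-! ### Mean values of almost periodic functions on the line -/

/-- The continuous function `f : ℝ → ℂ` has the mean value `c = lim_{T → ∞} T⁻¹ ∫₀ᵀ f`. -/
def HasMean (f : ℝ → ℂ) (c : ℂ) : Prop :=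
  Continuous f ∧ Tendsto (fun T : ℝ => (T : ℂ)⁻¹ * ∫ t in (0 : ℝ)..T, f t) atTop (𝓝 c)

/-- The character `t ↦ e^{-iμt}` of the real line. -/
noncomputable def lineChar (μ t : ℝ) : ℂ := Complex.exp (-(μ : ℂ) * ((t : ℂ) * Complex.I))

theorem lineChar_add (μ ν t : ℝ) : lineChar (μ + ν) t = lineChar μ t * lineChar ν t := by
  unfold lineChar
  rw [← Complex.exp_add]
  push_cast
  ring_nf

theorem lineChar_add_right (μ s t : ℝ) : lineChar μ (s + t) = lineChar μ s * lineChar μ t := by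
  unfold lineChar
  rw [← Complex.exp_add]
  push_cast
  ring_nf

theorem lineChar_zero (t : ℝ) : lineChar 0 t = 1 := by simp [lineChar]

theorem lineChar_neg (μ t : ℝ) : lineChar (-μ) t = starRingEnd ℂ (lineChar μ t) := by
  unfold lineChar
  rw [← Complex.exp_conj]
  simp

theorem lineChar_neg_right (μ t : ℝ) : lineChar μ (-t) = lineChar (-μ) t := by
  unfold lineChar
  push_cast
  ring_nf

theorem norm_lineChar (μ t : ℝ) : ‖lineChar μ t‖ = 1 := by
  unfold lineChar
  rw [Complex.norm_exp]
  simp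

theorem continuous_lineChar (μ : ℝ) : Continuous (lineChar μ) := by
  unfold lineChar
  fun_prop

namespace HasMean

theorem add {f g : ℝ → ℂ} {a b : ℂ} (hf : HasMean f a) (hg : HasMean g b) :
    HasMean (fun t => f t + g t) (a + b) := by
  refine ⟨hf.1.add hg.1, (hf.2.add hg.2).congr fun T => ?_⟩
  rw [intervalIntegral.integral_add (hf.1.intervalIntegrable _ _) (hg.1.intervalIntegrable _ _)]
  ring

theorem const_mul {f : ℝ → ℂ} {a : ℂ} (c : ℂ) (hf : HasMean f a) :
    HasMean (fun t => c * f t) (c * a) := by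
  refine ⟨continuous_const.mul hf.1, (hf.2.const_mul c).congr fun T => ?_⟩
  rw [intervalIntegral.integral_const_mul]
  ring

theorem zero : HasMean (fun _ => 0) 0 := ⟨continuous_const, by simp⟩

theorem sum {ι : Type*} {s : Finset ι} {f : ι → ℝ → ℂ} {a : ι → ℂ}
    (h : ∀ i ∈ s, HasMean (f i) (a i)) : HasMean (fun t => ∑ i ∈ s, f i t) (∑ i ∈ s, a i) := by
  classical
  induction s using Finset.induction_on with
  | empty => simpa using zero
  | insert i s hi ih =>
    simp only [Finset.sum_insert hi]
    exact (h i (by simp)).add (ih fun j hj => h j (by simp [hj]))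

/-- The majorant is itself a function with a mean, not a constant, so that the bound can be a mean
of squares evaluated by orthogonality. -/
theorem norm_le {f g : ℝ → ℂ} {a b : ℂ} (hf : HasMean f a) (hg : HasMean g b)
    (h : ∀ t, ‖f t‖ ≤ (g t).re) : ‖a‖ ≤ b.re := by
  refine le_of_tendsto_of_tendsto hf.2.norm ((Complex.continuous_re.tendsto b).comp hg.2) ?_
  filter_upwards [eventually_gt_atTop 0] with T hT
  have h1 : ‖∫ t in (0 : ℝ)..T, f t‖ ≤ ∫ t in (0 : ℝ)..T, (g t).re :=
    intervalIntegral.norm_integral_le_of_norm_le hT.le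
      (Eventually.of_forall fun t _ => h t)
      ((Complex.continuous_re.comp hg.1).intervalIntegrable _ _)
  have h2 : (∫ t in (0 : ℝ)..T, g t).re = ∫ t in (0 : ℝ)..T, (g t).re :=
    (Complex.reCLM.intervalIntegral_comp_comm (hg.1.intervalIntegrable _ _)).symm
  simp only [Function.comp]
  rw [norm_mul, norm_inv, Complex.norm_real, Real.norm_of_nonneg hT.le, ← Complex.ofReal_inv,
    Complex.re_ofReal_mul, h2]
  gcongr

end HasMean

theorem hasMean_one : HasMean (fun _ => 1) 1 := by
  refine ⟨continuous_const, tendsto_const_nhds.congr' ?_⟩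
  filter_upwards [eventually_gt_atTop 0] with T hT
  have : (T : ℂ) ≠ 0 := by exact_mod_cast hT.ne'
  simp [this]

theorem HasMean.norm_le_const {f : ℝ → ℂ} {a : ℂ} {C : ℝ} (hf : HasMean f a)
    (h : ∀ t, ‖f t‖ ≤ C) : ‖a‖ ≤ C := by
  have := hf.norm_le (hasMean_one.const_mul (C : ℂ)) (by simpa using h)
  simpa using this

theorem hasMean_lineChar (μ : ℝ) : HasMean (lineChar μ) (if μ = 0 then 1 else 0) := by
  split_ifs with h
  · subst h
    convert hasMean_one using 1
    funext t
    exact lineChar_zero t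
  · refine ⟨continuous_lineChar μ, squeeze_zero_norm' (a := fun T : ℝ => T⁻¹ * (2 / |μ|)) ?_ ?_⟩
    · filter_upwards [eventually_gt_atTop 0] with T hT
      have hc : -(μ : ℂ) * Complex.I ≠ 0 := by simp [h]
      have : ∫ t in (0 : ℝ)..T, lineChar μ t
          = (lineChar μ T - 1) / (-(μ : ℂ) * Complex.I) := by
        have := integral_exp_mul_complex (a := 0) (b := T) hc
        simp only [Complex.ofReal_zero, mul_zero, Complex.exp_zero] at this
        unfold lineChar
        convert this using 4 <;> ring
      rw [this, norm_mul, norm_inv, Complex.norm_real, Real.norm_of_nonneg hT.le, norm_div]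
      have h3 : ‖-(μ : ℂ) * Complex.I‖ = |μ| := by simp
      rw [h3]
      gcongr
      refine (norm_sub_le _ _).trans ?_
      rw [norm_lineChar]
      norm_num
    · simpa using (tendsto_inv_atTop_zero (𝕜 := ℝ)).mul_const (2 / |μ|)

/-! ### Rational independence of the logarithms of the primes -/

/-- The linear form `κ ↦ ∑_j κ_j log 𝔭_j`. -/
noncomputable def primeForm (n : ℕ) : (Fin n → ℤ) →+ ℝ where
  toFun κ := ∑ j : Fin n, (κ j : ℝ) * Real.log (Nat.nth Nat.Prime (j : ℕ))
  map_zero' := by simp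
  map_add' κ κ' := by simp [add_mul, Finset.sum_add_distrib]

theorem prime_nth (j : ℕ) : (Nat.nth Nat.Prime j).Prime :=
  Nat.nth_mem_of_infinite Nat.infinite_setOfPred_prime j

theorem prod_nth_prime_pow_injective (n : ℕ) :
    Function.Injective fun α : Fin n → ℕ => ∏ j : Fin n, Nat.nth Nat.Prime (j : ℕ) ^ α j := by
  intro α β h
  funext i
  have key : ∀ γ : Fin n → ℕ,
      (∏ j : Fin n, Nat.nth Nat.Prime (j : ℕ) ^ γ j).factorization (Nat.nth Nat.Prime (i : ℕ))
        = γ i := by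
    intro γ
    rw [Nat.factorization_prod fun (j : Fin n) _ => pow_ne_zero _ (prime_nth j).ne_zero]
    rw [Finsupp.finsetSum_apply, Finset.sum_eq_single i]
    · rw [(prime_nth i).factorization_pow]
      simp
    · intro j _ hj
      rw [(prime_nth j).factorization_pow, Finsupp.single_eq_of_ne]
      intro hp
      exact hj (Fin.ext (Nat.nth_injective Nat.infinite_setOfPred_prime hp).symm)
    · simp
  rw [← key α, ← key β]
  exact congrArg (fun x : ℕ => x.factorization (Nat.nth Nat.Prime (i : ℕ))) h

theorem log_prod_nth_prime_pow {n : ℕ} (α : Fin n → ℕ) :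
    Real.log ((∏ j : Fin n, Nat.nth Nat.Prime (j : ℕ) ^ α j : ℕ) : ℝ)
      = primeForm n fun j => (α j : ℤ) := by
  push_cast
  rw [Real.log_prod fun j _ => pow_ne_zero _ (by exact_mod_cast (prime_nth j).ne_zero)]
  simp [primeForm]

/-- Splitting `κ` into positive and negative parts turns a vanishing form into an equality of two
integers, and unique factorization applies. -/
theorem primeForm_injective (n : ℕ) : Function.Injective (primeForm n) := by
  rw [injective_iff_map_eq_zero]
  intro κ hκ
  have h : primeForm n (fun j => ((κ j).toNat : ℤ)) = primeForm n fun j => ((-κ j).toNat : ℤ) := by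
    rw [← sub_eq_zero, ← map_sub, ← hκ]
    congr 1
    funext j
    simp only [Pi.sub_apply]
    omega
  rw [← log_prod_nth_prime_pow (fun j => (κ j).toNat),
    ← log_prod_nth_prime_pow (fun j => (-κ j).toNat)] at h
  have hpos : ∀ γ : Fin n → ℕ, (0 : ℝ) < (∏ j : Fin n, Nat.nth Nat.Prime (j : ℕ) ^ γ j : ℕ) := by
    intro γ
    exact_mod_cast Finset.prod_pos fun (j : Fin n) _ => pow_pos (prime_nth j).pos _
  have h2 := Real.log_injOn_pos (hpos _) (hpos _) h
  have h3 := prod_nth_prime_pow_injective n (by exact_mod_cast h2)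
  funext j
  have := congrFun h3 j
  simp only [Pi.zero_apply]
  omega

theorem hasMean_lineChar_primeForm {n : ℕ} (κ : Fin n → ℤ) :
    HasMean (lineChar (primeForm n κ)) (if κ = 0 then 1 else 0) := by
  convert hasMean_lineChar (primeForm n κ) using 2
  simp [map_eq_zero_iff _ (primeForm_injective n)]

/-- The point `(𝔭_1^{-it}, …, 𝔭_n^{-it})` of the torus; its powers are the Dirichlet characters. -/
theorem prod_lineChar_zpow {n : ℕ} (κ : Fin n → ℤ) (t : ℝ) :
    ∏ j : Fin n, lineChar (Real.log (Nat.nth Nat.Prime (j : ℕ))) t ^ κ j = lineChar (primeForm n κ) t := by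
  unfold lineChar primeForm
  simp only [AddMonoidHom.coe_mk, ZeroHom.coe_mk, ← Complex.exp_int_mul, ← Complex.exp_sum]
  congr 1
  push_cast
  rw [← Finset.sum_neg_distrib, Finset.sum_mul]
  exact Finset.sum_congr rfl fun j _ => by ring

/-! ### Evaluation at points of the torus is contractive -/

/-- The Dirichlet character `t ↦ (𝔭^α)^{-it}`. -/
noncomputable def indexChar {n : ℕ} (α : Fin n → ℕ) (t : ℝ) : ℂ :=
  lineChar (primeForm n fun j => (α j : ℤ)) t

/-- Orthogonality of the Dirichlet characters. The index families need not be injective, so a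
product of two polynomials may be entered unexpanded, indexed by pairs with exponent `α + β`. -/
theorem hasMean_sum_mul_conj_sum {n : ℕ} {ι ι' : Type*} (s : Finset ι) (s' : Finset ι')
    (c : ι → ℂ) (d : ι' → ℂ) (κ : ι → Fin n → ℕ) (κ' : ι' → Fin n → ℕ) :
    HasMean (fun t => (∑ i ∈ s, c i * indexChar (κ i) t) *
        starRingEnd ℂ (∑ j ∈ s', d j * indexChar (κ' j) t))
      (∑ i ∈ s, ∑ j ∈ s', if κ i = κ' j then c i * starRingEnd ℂ (d j) else 0) := by
  have h : ∀ i ∈ s, HasMean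
      (fun t => ∑ j ∈ s', (c i * starRingEnd ℂ (d j)) *
        lineChar (primeForm n ((fun l => (κ i l : ℤ)) - fun l => (κ' j l : ℤ))) t)
      (∑ j ∈ s', if κ i = κ' j then c i * starRingEnd ℂ (d j) else 0) := by
    intro i _
    refine HasMean.sum fun j _ => ?_
    convert (hasMean_lineChar_primeForm
      ((fun l => (κ i l : ℤ)) - fun l => (κ' j l : ℤ))).const_mul (c i * starRingEnd ℂ (d j)) using 1
    have : (κ i = κ' j) ↔ ((fun l => (κ i l : ℤ)) - fun l => (κ' j l : ℤ)) = 0 := by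
      rw [sub_eq_zero, funext_iff, funext_iff]
      simp
    simp only [this, mul_ite, mul_one, mul_zero]
  convert HasMean.sum h using 2 with t
  rw [map_sum, Finset.sum_mul_sum]
  refine Finset.sum_congr rfl fun i _ => Finset.sum_congr rfl fun j _ => ?_
  rw [map_sub, sub_eq_add_neg, lineChar_add, lineChar_neg, map_mul]
  unfold indexChar
  ring

theorem card_multiIndexLe (m n : ℕ) : (multiIndexLe m n).card = (m + 1) ^ n := by
  simp [multiIndexLe]

theorem mem_multiIndexLe {m n : ℕ} {α : Fin n → ℕ} :
    α ∈ multiIndexLe m n ↔ ∀ j, α j ≤ m := by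
  simp [multiIndexLe]

theorem hasMean_normSq_box {n : ℕ} (R : ℕ) {z : Fin n → ℂ} (hz : ∀ j, ‖z j‖ = 1) :
    HasMean (fun t =>
      (∑ β ∈ multiIndexLe R n, (∏ j, starRingEnd ℂ (z j) ^ β j) * indexChar β t) *
        starRingEnd ℂ (∑ β ∈ multiIndexLe R n, (∏ j, starRingEnd ℂ (z j) ^ β j) * indexChar β t))
      (((R : ℝ) + 1) ^ n : ℝ) := by
  convert hasMean_sum_mul_conj_sum (multiIndexLe R n) (multiIndexLe R n)
    (fun β => ∏ j, starRingEnd ℂ (z j) ^ β j) (fun β => ∏ j, starRingEnd ℂ (z j) ^ β j) id id using 1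
  · rfl
  have : ∀ β ∈ multiIndexLe R n, (∑ γ ∈ multiIndexLe R n, if id β = id γ then
      (∏ j, starRingEnd ℂ (z j) ^ β j) * starRingEnd ℂ (∏ j, starRingEnd ℂ (z j) ^ γ j) else 0)
      = 1 := by
    intro β hβ
    simp only [id, Finset.sum_ite_eq, hβ, if_true]
    rw [Complex.mul_conj, Complex.normSq_eq_norm_sq]
    simp [hz]
  rw [Finset.sum_congr rfl this, Finset.sum_const, card_multiIndexLe]
  simp

/-- This replaces Kronecker's density theorem. Let `A_R` be the sum of `z̄^β` times the character of
`β` over the box of side `R`. Multiplying the polynomial by `A_R` and pairing with `A_{R+m}` has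
mean `(R+1)^n p`, since `α + β` always stays in the larger box. The inequality `2|A||B| ≤ |A|² +
|B|²` and the two box sizes give `key`; the ratio of the sizes tends to `1`. -/
theorem norm_eval_torus_le {m n : ℕ} (a : (Fin n → ℕ) → ℂ) {C : ℝ}
    (h : ∀ t, ‖∑ α ∈ multiIndexLe m n, a α * indexChar α t‖ ≤ C)
    {z : Fin n → ℂ} (hz : ∀ j, ‖z j‖ = 1) :
    ‖∑ α ∈ multiIndexLe m n, a α * ∏ j, z j ^ α j‖ ≤ C := by
  have hC : 0 ≤ C := (norm_nonneg _).trans (h 0)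
  set p : ℂ := ∑ α ∈ multiIndexLe m n, a α * ∏ j, z j ^ α j with hp
  have key : ∀ R : ℕ, ‖p‖ ≤ C / 2 * (1 + (((R : ℝ) + m + 1) / (R + 1)) ^ n) := by
    intro R
    set c : (Fin n → ℕ) → ℂ := fun β => ∏ j, starRingEnd ℂ (z j) ^ β j with hc
    have h1 := hasMean_sum_mul_conj_sum (multiIndexLe m n ×ˢ multiIndexLe R n)
      (multiIndexLe (R + m) n) (fun i => a i.1 * c i.2) c (fun i => i.1 + i.2) id
    have hmean : (∑ i ∈ multiIndexLe m n ×ˢ multiIndexLe R n, ∑ j ∈ multiIndexLe (R + m) n,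
        if i.1 + i.2 = id j then a i.1 * c i.2 * starRingEnd ℂ (c j) else 0)
        = ((R : ℂ) + 1) ^ n * p := by
      rw [Finset.sum_product, hp, Finset.mul_sum]
      refine Finset.sum_congr rfl fun α hα => ?_
      have : ∀ β ∈ multiIndexLe R n, (∑ j ∈ multiIndexLe (R + m) n,
          if α + β = id j then a α * c β * starRingEnd ℂ (c j) else 0)
          = a α * ∏ j, z j ^ α j := by
        intro β hβ
        have hmem : α + β ∈ multiIndexLe (R + m) n := by
          rw [mem_multiIndexLe] at *
          intro j
          have := hα j
          have := hβ j
          simp only [Pi.add_apply]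
          omega
        simp only [id, Finset.sum_ite_eq, hmem, if_true]
        rw [mul_assoc]
        congr 1
        simp only [hc, map_prod, ← Finset.prod_mul_distrib, map_pow, Complex.conj_conj]
        refine Finset.prod_congr rfl fun j _ => ?_
        have : starRingEnd ℂ (z j) * z j = 1 := by
          rw [mul_comm, Complex.mul_conj, Complex.normSq_eq_norm_sq]
          simp [hz]
        rw [Pi.add_apply, pow_add, mul_left_comm, ← mul_pow, this, one_pow, mul_one]
      rw [Finset.sum_congr rfl this, Finset.sum_const, card_multiIndexLe]
      simp
    rw [hmean] at h1
    have h2 := ((hasMean_normSq_box R hz).add (hasMean_normSq_box (R + m) hz)).const_mul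
      ((C / 2 : ℝ) : ℂ)
    have h3 := h1.norm_le h2 ?_
    · have hR : (0 : ℝ) < (R : ℝ) + 1 := by positivity
      rw [norm_mul, norm_pow] at h3
      have e1 : ‖(R : ℂ) + 1‖ = (R : ℝ) + 1 := by
        rw [show (R : ℂ) + 1 = (((R : ℝ) + 1 : ℝ) : ℂ) by push_cast; rfl, Complex.norm_real,
          Real.norm_of_nonneg hR.le]
      rw [e1, ← Complex.ofReal_add, ← Complex.ofReal_mul, Complex.ofReal_re] at h3
      have hpow : (0 : ℝ) < ((R : ℝ) + 1) ^ n := by positivity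
      rw [div_pow, ← mul_le_mul_iff_right₀ hpow]
      refine h3.trans_eq ?_
      field_simp
      push_cast
      rfl
    · intro t
      set A : ℂ := ∑ β ∈ multiIndexLe R n, c β * indexChar β t with hA
      set B : ℂ := ∑ β ∈ multiIndexLe (R + m) n, c β * indexChar β t with hB
      have hprod : ∑ i ∈ multiIndexLe m n ×ˢ multiIndexLe R n,
          a i.1 * c i.2 * indexChar (i.1 + i.2) t
          = (∑ α ∈ multiIndexLe m n, a α * indexChar α t) * A := by
        rw [hA, Finset.sum_mul_sum, Finset.sum_product]
        refine Finset.sum_congr rfl fun α _ => Finset.sum_congr rfl fun β _ => ?_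
        have : indexChar (α + β) t = indexChar α t * indexChar β t := by
          unfold indexChar
          rw [← lineChar_add, ← map_add]
          congr 2
        simp only [this]
        ring
      have hB' : (∑ j ∈ multiIndexLe (R + m) n, c j * indexChar (id j) t) = B := rfl
      simp only [hprod, hB']
      rw [Complex.mul_conj, Complex.mul_conj, ← Complex.ofReal_add, ← Complex.ofReal_mul,
        Complex.ofReal_re, norm_mul, norm_mul, RCLike.norm_conj, Complex.normSq_eq_norm_sq,
        Complex.normSq_eq_norm_sq]
      calc _ ≤ C * ‖A‖ * ‖B‖ := by gcongr; exact h t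
        _ ≤ _ := by nlinarith [mul_nonneg hC (sq_nonneg (‖A‖ - ‖B‖))]
  refine ge_of_tendsto' (x := atTop) (f := fun R : ℕ =>
    C / 2 * (1 + (((R : ℝ) + m + 1) / (R + 1)) ^ n)) ?_ key
  have h0 : Tendsto (fun R : ℕ => ((R : ℝ) + m + 1) / (R + 1)) atTop (𝓝 1) := by
    have : Tendsto (fun R : ℕ => 1 + (m : ℝ) * (1 / ((R : ℝ) + 1))) atTop (𝓝 (1 + m * 0)) :=
      tendsto_const_nhds.add (tendsto_const_nhds.mul tendsto_one_div_add_atTop_nhds_zero_nat)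
    rw [mul_zero, add_zero] at this
    refine this.congr fun R => ?_
    have hR : (R : ℝ) + 1 ≠ 0 := by positivity
    field_simp
    ring
  have := ((h0.pow n).const_add 1).const_mul (C / 2)
  rwa [one_pow, show C / 2 * (1 + 1) = C by ring] at this

/-! ### The Dirichlet kernel and its Riemann sums -/

/-- The analytic Dirichlet kernel `∑_{k ≤ m} e^{ikθ}`. -/
noncomputable def dirichletKer (m : ℕ) (θ : ℝ) : ℂ :=
  ∑ k ∈ Finset.range (m + 1), Complex.exp ((θ : ℂ) * Complex.I) ^ k

/-- The Lebesgue constant `(2π)⁻¹ ∫₀^{2π} |∑_{k ≤ m} e^{ikθ}| dθ`. -/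
noncomputable def lebesgueConst (m : ℕ) : ℝ :=
  (2 * Real.pi)⁻¹ * ∫ θ in (0 : ℝ)..(2 * Real.pi), ‖dirichletKer m θ‖

theorem continuous_dirichletKer (m : ℕ) : Continuous (dirichletKer m) := by
  unfold dirichletKer
  fun_prop

theorem periodic_dirichletKer (m : ℕ) : Function.Periodic (dirichletKer m) (2 * Real.pi) := by
  intro θ
  unfold dirichletKer
  have : Complex.exp (((θ + 2 * Real.pi : ℝ) : ℂ) * Complex.I)
      = Complex.exp ((θ : ℂ) * Complex.I) := by
    push_cast
    rw [add_mul, Complex.exp_periodic]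
  rw [this]

theorem lebesgueConst_nonneg (m : ℕ) : 0 ≤ lebesgueConst m := by
  unfold lebesgueConst
  have : 0 ≤ ∫ θ in (0 : ℝ)..(2 * Real.pi), ‖dirichletKer m θ‖ :=
    intervalIntegral.integral_nonneg (by positivity) fun _ _ => norm_nonneg _
  positivity

theorem norm_dirichletKer_sub_le (m : ℕ) (x y : ℝ) :
    ‖dirichletKer m x - dirichletKer m y‖ ≤ (∑ k ∈ Finset.range (m + 1), (k : ℝ)) * |x - y| := by
  unfold dirichletKer
  rw [← Finset.sum_sub_distrib, Finset.sum_mul]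
  refine (norm_sum_le _ _).trans (Finset.sum_le_sum fun k _ => ?_)
  have h : Complex.exp ((x : ℂ) * Complex.I) ^ k - Complex.exp ((y : ℂ) * Complex.I) ^ k
      = Complex.exp ((y : ℂ) * Complex.I) ^ k *
        (Complex.exp (Complex.I * ((k * (x - y) : ℝ) : ℂ)) - 1) := by
    rw [mul_sub, mul_one, ← Complex.exp_nat_mul, ← Complex.exp_nat_mul, ← Complex.exp_add]
    push_cast
    ring_nf
  rw [h, norm_mul, norm_pow, Complex.norm_exp_ofReal_mul_I, one_pow, one_mul]
  refine Real.norm_exp_I_mul_ofReal_sub_one_le.trans ?_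
  rw [Real.norm_eq_abs, abs_mul, Nat.abs_cast]

/-- On each cell `g` is at least its left value minus `K` times the mesh. Periodicity makes the
total integral independent of `θ`, so the bound is uniform in the offset. -/
theorem riemannSum_le_of_periodic {g : ℝ → ℝ} {T K : ℝ} (hT : 0 < T) (hg : Continuous g)
    (hper : Function.Periodic g T) (hlip : ∀ x y, |g x - g y| ≤ K * |x - y|)
    (hK : 0 ≤ K) {N : ℕ} (hN : 0 < N) (θ : ℝ) :
    (N : ℝ)⁻¹ * ∑ k ∈ Finset.range N, g (θ + k * (T / N))
      ≤ T⁻¹ * (∫ x in (0 : ℝ)..T, g x) + K * (T / N) := by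
  have hN' : (0 : ℝ) < N := by exact_mod_cast hN
  set h : ℝ := T / N with hh
  have hpos : 0 < h := by positivity
  have hstep : ∀ k : ℕ, h * (g (θ + k * h) - K * h)
      ≤ ∫ x in (θ + k * h)..(θ + (k + 1 : ℕ) * h), g x := by
    intro k
    have hle : θ + k * h ≤ θ + (k + 1 : ℕ) * h := by push_cast; nlinarith
    have := intervalIntegral.integral_mono_on (μ := MeasureTheory.volume)
      (f := fun _ => g (θ + k * h) - K * h) (g := g) hle
      (by simp) (hg.intervalIntegrable _ _) (fun x hx => by
        have h1 := (abs_le.1 (hlip x (θ + k * h))).1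
        have h2 : |x - (θ + k * h)| ≤ h := by
          rw [abs_of_nonneg (by linarith [hx.1])]
          have := hx.2
          push_cast at this
          linarith
        nlinarith)
    rw [intervalIntegral.integral_const, smul_eq_mul] at this
    refine le_trans (le_of_eq ?_) this
    push_cast
    ring
  have hsum := Finset.sum_le_sum fun k (_ : k ∈ Finset.range N) => hstep k
  rw [intervalIntegral.sum_integral_adjacent_intervals (a := fun k : ℕ => θ + k * h)
    fun k _ => hg.intervalIntegrable _ _] at hsum
  have hend : θ + (N : ℝ) * h = θ + T := by rw [hh]; field_simp
  simp only [Nat.cast_zero, zero_mul, add_zero] at hsum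
  rw [hend, hper.intervalIntegral_add_eq θ 0, zero_add, ← Finset.mul_sum, Finset.sum_sub_distrib,
    Finset.sum_const, Finset.card_range, nsmul_eq_mul] at hsum
  set S := ∑ k ∈ Finset.range N, g (θ + k * h)
  have hNh : h = T * (N : ℝ)⁻¹ := by rw [hh]; rfl
  have h3 : T * ((N : ℝ)⁻¹ * S) ≤ (∫ x in (0 : ℝ)..T, g x) + T * (K * h) := by
    have e : h * (S - N * (K * h)) = T * ((N : ℝ)⁻¹ * S) - T * (K * h) := by
      have : h * N = T := by rw [hh]; field_simp
      calc _ = h * S - (h * N) * (K * h) := by ring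
        _ = _ := by rw [this, hNh]; ring
    linarith
  have h4 := mul_le_mul_of_nonneg_left h3 (inv_nonneg.2 hT.le)
  rw [← mul_assoc, inv_mul_cancel₀ hT.ne', one_mul, mul_add, ← mul_assoc T⁻¹ T,
    inv_mul_cancel₀ hT.ne', one_mul] at h4
  exact h4

/-- Uniformity in `θ` is essential, as the offsets will be `-t log 𝔭_j` for all real `t`. The
condition `m < N` prevents aliasing on the grid. -/
theorem exists_riemannSum_dirichletKer_le (m : ℕ) {ε : ℝ} (hε : 0 < ε) :
    ∃ N : ℕ, m < N ∧ ∀ θ : ℝ, (N : ℝ)⁻¹ *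
      ∑ k ∈ Finset.range N, ‖dirichletKer m (θ + k * (2 * Real.pi / N))‖
        ≤ lebesgueConst m + ε := by
  set K : ℝ := ∑ k ∈ Finset.range (m + 1), (k : ℝ) with hK
  have hK0 : 0 ≤ K := Finset.sum_nonneg fun _ _ => Nat.cast_nonneg _
  have hlim : Tendsto (fun N : ℕ => K * (2 * Real.pi / N)) atTop (𝓝 0) := by
    simpa using (tendsto_const_div_atTop_nhds_zero_nat (2 * Real.pi)).const_mul K
  obtain ⟨N, hN, hmN⟩ := ((hlim.eventually_le_const hε).and (eventually_gt_atTop m)).exists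
  refine ⟨N, hmN, fun θ => ?_⟩
  refine (riemannSum_le_of_periodic (g := fun θ => ‖dirichletKer m θ‖) Real.two_pi_pos
    (continuous_dirichletKer m).norm (fun x => by simp only [periodic_dirichletKer m x])
    (fun x y => (abs_norm_sub_norm_le _ _).trans (norm_dirichletKer_sub_le m x y)) hK0
    (by omega) θ).trans ?_
  exact add_le_add le_rfl hN

/-- For exponents below `N`, distinct ones give a ratio `ζ^(b-a) ≠ 1` of `N`-th roots of unity,
whose geometric sum vanishes. -/
theorem sum_rootOfUnity_pow {N a b : ℕ} (ha : a < N) (hb : b < N) :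
    ∑ k ∈ Finset.range N, Complex.exp (((-(k * (2 * Real.pi / N)) : ℝ) : ℂ) * Complex.I) ^ a *
      Complex.exp (((k * (2 * Real.pi / N) : ℝ) : ℂ) * Complex.I) ^ b
      = if a = b then (N : ℂ) else 0 := by
  have hN : N ≠ 0 := by omega
  have hζ := Complex.isPrimitiveRoot_exp N hN
  set ζ := Complex.exp (2 * Real.pi * Complex.I / N) with hζdef
  have hζ0 : ζ ≠ 0 := Complex.exp_ne_zero _
  have e1 : ∀ k : ℕ, Complex.exp (((k * (2 * Real.pi / N) : ℝ) : ℂ) * Complex.I) = ζ ^ k := by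
    intro k
    rw [hζdef, ← Complex.exp_nat_mul]
    push_cast
    ring_nf
  have e2 : ∀ k : ℕ, Complex.exp (((-(k * (2 * Real.pi / N)) : ℝ) : ℂ) * Complex.I)
      = (ζ ^ k)⁻¹ := by
    intro k
    rw [← e1, ← Complex.exp_neg]
    push_cast
    ring_nf
  have e3 : ∀ k : ℕ, ((ζ ^ k)⁻¹) ^ a * (ζ ^ k) ^ b = (ζ ^ b / ζ ^ a) ^ k := by
    intro k
    rw [div_pow, inv_pow, div_eq_mul_inv, mul_comm, ← pow_mul, ← pow_mul, ← pow_mul, ← pow_mul,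
      mul_comm k b, mul_comm k a]
  simp only [e1, e2, e3]
  split_ifs with hab
  · subst hab
    simp [hζ0]
  · set η := ζ ^ b / ζ ^ a with hη
    have hη1 : η ≠ 1 := by
      intro h
      rw [hη, div_eq_one_iff_eq (pow_ne_zero _ hζ0)] at h
      exact hab (hζ.pow_inj hb ha h).symm
    have hηN : η ^ N = 1 := by
      rw [hη, div_pow, ← pow_mul, ← pow_mul, mul_comm b, mul_comm a, pow_mul, pow_mul,
        hζ.pow_eq_one]
      simp
    have := mul_geom_sum η N
    rw [hηN, sub_self] at this
    exact (mul_eq_zero.1 this).resolve_left (sub_ne_zero.2 hη1)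

/-! ### The upper bound -/

namespace HInf

theorem norm_toFun_le {ω : ℕ → ℝ} {J : Finset ℕ} (D : HInf ω J) (t : ℝ) :
    ‖D.toFun ((t : ℂ) * Complex.I)‖ ≤ ‖D‖ :=
  (restrictImag D).norm_coe_le_norm t

theorem norm_le_of_forall {ω : ℕ → ℝ} {J : Finset ℕ} {D : HInf ω J} {C : ℝ} (hC : 0 ≤ C)
    (h : ∀ t : ℝ, ‖D.toFun ((t : ℂ) * Complex.I)‖ ≤ C) : ‖D‖ ≤ C :=
  (BoundedContinuousFunction.norm_le (f := restrictImag D) hC).2 h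

variable {m n : ℕ}

theorem sum_NInf (f : ℕ → ℂ) :
    ∑ k ∈ NInf m n, f k
      = ∑ α ∈ multiIndexLe m n, f (∏ j : Fin n, Nat.nth Nat.Prime (j : ℕ) ^ α j) :=
  Finset.sum_image fun _ _ _ _ h => prod_nth_prime_pow_injective n h

/-- The Dirichlet polynomial `∑_α a_α (𝔭^α)^{-s}`. -/
noncomputable def ofCoeff (m n : ℕ) : ((Fin n → ℕ) → ℂ) →ₗ[ℂ] HInf logFreq (NInf m n) where
  toFun a := ⟨fun s => ∑ α ∈ multiIndexLe m n,
      a α * Complex.exp (-((primeForm n fun j => (α j : ℤ) : ℝ) : ℂ) * s), by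
    refine ⟨fun k => a (Function.invFun
      (fun α : Fin n → ℕ => ∏ j : Fin n, Nat.nth Nat.Prime (j : ℕ) ^ α j) k), fun s => ?_⟩
    rw [sum_NInf]
    refine Finset.sum_congr rfl fun α _ => congrArg₂ (· * ·) (congrArg a
      (Function.leftInverse_invFun (prod_nth_prime_pow_injective n) α)).symm ?_
    rw [logFreq, log_prod_nth_prime_pow]⟩
  map_add' a b := Subtype.ext <| funext fun s => by
    change ∑ α ∈ multiIndexLe m n, (a α + b α) * Complex.exp (-((primeForm n fun j => (α j : ℤ) : ℝ) : ℂ) * s)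
      = (∑ α ∈ multiIndexLe m n, a α * Complex.exp (-((primeForm n fun j => (α j : ℤ) : ℝ) : ℂ) * s))
        + ∑ α ∈ multiIndexLe m n, b α * Complex.exp (-((primeForm n fun j => (α j : ℤ) : ℝ) : ℂ) * s)
    simp [add_mul, Finset.sum_add_distrib]
  map_smul' c a := Subtype.ext <| funext fun s => by
    change ∑ α ∈ multiIndexLe m n, (c * a α) * Complex.exp (-((primeForm n fun j => (α j : ℤ) : ℝ) : ℂ) * s)
      = c * ∑ α ∈ multiIndexLe m n, a α * Complex.exp (-((primeForm n fun j => (α j : ℤ) : ℝ) : ℂ) * s)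
    simp [Finset.mul_sum, mul_assoc]

theorem ofCoeff_toFun (a : (Fin n → ℕ) → ℂ) (t : ℝ) :
    (ofCoeff m n a).toFun ((t : ℂ) * Complex.I)
      = ∑ α ∈ multiIndexLe m n, a α * indexChar α t := rfl

theorem ofCoeff_surjective : Function.Surjective (ofCoeff m n) := by
  intro D
  obtain ⟨b, hb⟩ := D.exists_coeff
  refine ⟨fun α => b (∏ j : Fin n, Nat.nth Nat.Prime (j : ℕ) ^ α j), Subtype.ext <| funext fun s => ?_⟩
  refine Eq.trans ?_ (hb s).symm
  rw [sum_NInf]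
  refine Finset.sum_congr rfl fun α _ => ?_
  rw [logFreq, log_prod_nth_prime_pow]

theorem ofCoeff_congr {a b : (Fin n → ℕ) → ℂ} (h : ∀ α ∈ multiIndexLe m n, a α = b α) :
    ofCoeff m n a = ofCoeff m n b :=
  Subtype.ext <| funext fun s => Finset.sum_congr rfl fun α hα => by rw [h α hα]

/-- A linear section is all that is needed; its values outside the box are irrelevant, and
uniqueness of coefficients is not used. -/
theorem exists_coeffMap : ∃ g : HInf logFreq (NInf m n) →ₗ[ℂ] ((Fin n → ℕ) → ℂ),
    ∀ D, ofCoeff m n (g D) = D := by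
  obtain ⟨g, hg⟩ := (ofCoeff m n).exists_rightInverse_of_surjective
    (LinearMap.range_eq_top.2 ofCoeff_surjective)
  exact ⟨g, fun D => LinearMap.congr_fun hg D⟩

/-- Functionals on a superspace of `H_∞^J` that extend a point evaluation on the torus. -/
theorem exists_extension_eval {Y : Type*} [NormedAddCommGroup Y] [NormedSpace ℂ Y]
    (I : HInf logFreq (NInf m n) →ₗᵢ[ℂ] Y) {g : HInf logFreq (NInf m n) →ₗ[ℂ] ((Fin n → ℕ) → ℂ)}
    (hg : ∀ D, ofCoeff m n (g D) = D) {z : Fin n → ℂ} (hz : ∀ j, ‖z j‖ = 1) :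
    ∃ φ : Y →L[ℂ] ℂ, ‖φ‖ ≤ 1 ∧
      ∀ D, φ (I D) = ∑ α ∈ multiIndexLe m n, g D α * ∏ j, z j ^ α j := by
  let ev : HInf logFreq (NInf m n) →ₗ[ℂ] ℂ :=
    { toFun := fun D => ∑ α ∈ multiIndexLe m n, g D α * ∏ j, z j ^ α j
      map_add' := fun D E => by simp [add_mul, Finset.sum_add_distrib]
      map_smul' := fun c D => by simp [Finset.mul_sum, mul_assoc] }
  have hev : ∀ D, ‖ev D‖ ≤ 1 * ‖D‖ := fun D => by
    rw [one_mul]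
    refine norm_eval_torus_le (g D) (fun t => ?_) hz
    rw [← ofCoeff_toFun, hg]
    exact norm_toFun_le D t
  let E := I.equivRange
  obtain ⟨φ, hφ, hnorm⟩ := exists_extension_norm_eq (LinearMap.range I.toLinearMap)
    ((ev.mkContinuous 1 hev).comp (E.symm.toLinearIsometry.toContinuousLinearMap))
  refine ⟨φ, ?_, fun D => ?_⟩
  · rw [hnorm]
    refine ContinuousLinearMap.opNorm_le_bound _ zero_le_one fun y => ?_
    refine (hev _).trans ?_
    simp
  · have h1 := hφ (E D)
    refine Eq.trans h1 ?_
    simp [ev]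

/-- The projection is a discretized convolution with the product kernel. A finite grid is used
because the Hahn–Banach extensions are chosen point by point, with no regularity in the torus point
that would allow integration. -/
theorem exists_projection_norm_le {Y : Type*} [NormedAddCommGroup Y] [NormedSpace ℂ Y]
    (I : HInf logFreq (NInf m n) →ₗᵢ[ℂ] Y) {N : ℕ} (hN : m < N) {B : ℝ}
    (hB : ∀ θ : ℝ, (N : ℝ)⁻¹ *
      ∑ k ∈ Finset.range N, ‖dirichletKer m (θ + k * (2 * Real.pi / N))‖ ≤ B) :
    ∃ P : Y →L[ℂ] LinearMap.range I.toLinearMap,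
      (∀ x : LinearMap.range I.toLinearMap, P (x : Y) = x) ∧ ‖P‖ ≤ B ^ n := by
  have hN0 : (0 : ℝ) < N := by exact_mod_cast (by omega : 0 < N)
  have hB0 : 0 ≤ B := le_trans (mul_nonneg (by positivity)
    (Finset.sum_nonneg fun _ _ => norm_nonneg _)) (hB 0)
  obtain ⟨g, hg⟩ := exists_coeffMap (m := m) (n := n)
  -- The grid points `z k` and their conjugates `w k`: the functionals evaluate at `z k`, and `w k`
  -- supplies the dual characters.
  let z : (Fin n → ℕ) → Fin n → ℂ := fun k j =>
    Complex.exp (((-(k j * (2 * Real.pi / N)) : ℝ) : ℂ) * Complex.I)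
  let w : (Fin n → ℕ) → Fin n → ℂ := fun k j =>
    Complex.exp (((k j * (2 * Real.pi / N) : ℝ) : ℂ) * Complex.I)
  have hφ := fun k : Fin n → ℕ => exists_extension_eval I hg (z := z k)
    (fun j => Complex.norm_exp_ofReal_mul_I _)
  choose φ hφ1 hφ2 using hφ
  let G : Finset (Fin n → ℕ) := Fintype.piFinset fun _ => Finset.range N
  let Q : Y →L[ℂ] HInf logFreq (NInf m n) := ((N : ℂ)⁻¹ ^ n) •
    ∑ k ∈ G, (φ k).smulRight (ofCoeff m n fun α => ∏ j, w k j ^ α j)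
  have hQ : ∀ y, Q y = ofCoeff m n (fun α => (N : ℂ)⁻¹ ^ n * ∑ k ∈ G, φ k y * ∏ j, w k j ^ α j) := by
    intro y
    have : (fun α : Fin n → ℕ => (N : ℂ)⁻¹ ^ n * ∑ k ∈ G, φ k y * ∏ j, w k j ^ α j)
        = (N : ℂ)⁻¹ ^ n • ∑ k ∈ G, φ k y • fun α : Fin n → ℕ => ∏ j, w k j ^ α j := by
      funext α
      simp [Finset.sum_apply]
    rw [this, map_smul, map_sum]
    simp [Q]
  have hQI : ∀ D, Q (I D) = D := by
    intro D
    rw [hQ]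
    conv_rhs => rw [← hg D]
    refine ofCoeff_congr fun β hβ => ?_
    have hval : ∀ α ∈ multiIndexLe m n,
        (∑ k ∈ G, (∏ j, z k j ^ α j) * ∏ j, w k j ^ β j) = if α = β then (N : ℂ) ^ n else 0 := by
      intro α hα
      rw [mem_multiIndexLe] at hα hβ
      simp only [← Finset.prod_mul_distrib]
      have h1 := Finset.sum_prod_piFinset (ι := Fin n) (Finset.range N) (fun j k =>
        Complex.exp (((-(k * (2 * Real.pi / N)) : ℝ) : ℂ) * Complex.I) ^ α j *
        Complex.exp (((k * (2 * Real.pi / N) : ℝ) : ℂ) * Complex.I) ^ β j)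
      refine h1.trans ?_
      rw [Finset.prod_congr rfl fun j _ =>
        sum_rootOfUnity_pow ((hα j).trans_lt hN) ((hβ j).trans_lt hN)]
      split_ifs with h
      · subst h
        simp
      · obtain ⟨j, hj⟩ := Function.ne_iff.1 h
        exact Finset.prod_eq_zero (Finset.mem_univ j) (if_neg hj)
    simp only [hφ2, Finset.sum_mul]
    rw [Finset.sum_comm]
    simp only [mul_assoc, ← Finset.mul_sum]
    rw [Finset.sum_congr rfl fun α hα => by rw [hval α hα]]
    simp only [mul_ite, mul_zero, Finset.sum_ite_eq', hβ, if_true]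
    have : (N : ℂ) ≠ 0 := by exact_mod_cast hN0.ne'
    rw [inv_pow]
    field_simp
  have hQn : ∀ y, ‖Q y‖ ≤ B ^ n * ‖y‖ := by
    intro y
    refine norm_le_of_forall (by positivity) fun t => ?_
    rw [hQ, ofCoeff_toFun]
    have hchar : ∀ (k α : Fin n → ℕ), (∏ j, w k j ^ α j) * indexChar α t
        = ∏ j : Fin n, Complex.exp (((-(Real.log (Nat.nth Nat.Prime (j : ℕ)) * t)
          + k j * (2 * Real.pi / N) : ℝ) : ℂ) * Complex.I) ^ α j := by
      intro k α
      rw [indexChar, ← prod_lineChar_zpow, ← Finset.prod_mul_distrib]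
      refine Finset.prod_congr rfl fun j _ => ?_
      rw [zpow_natCast, ← mul_pow]
      congr 1
      simp only [w, lineChar, ← Complex.exp_add]
      congr 1
      push_cast
      ring
    have hker : ∀ k : Fin n → ℕ, (∑ α ∈ multiIndexLe m n, (∏ j, w k j ^ α j) * indexChar α t)
        = ∏ j : Fin n, dirichletKer m (-(Real.log (Nat.nth Nat.Prime (j : ℕ)) * t)
          + k j * (2 * Real.pi / N)) := by
      intro k
      simp only [hchar, dirichletKer]
      rw [Finset.prod_univ_sum]
      refine Finset.sum_congr ?_ fun _ _ => rfl
      ext α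
      simp [mem_multiIndexLe]
    have hrw : ∑ α ∈ multiIndexLe m n,
        ((N : ℂ)⁻¹ ^ n * ∑ k ∈ G, φ k y * ∏ j, w k j ^ α j) * indexChar α t
        = (N : ℂ)⁻¹ ^ n * ∑ k ∈ G, φ k y *
          ∏ j : Fin n, dirichletKer m (-(Real.log (Nat.nth Nat.Prime (j : ℕ)) * t)
          + k j * (2 * Real.pi / N)) := by
      simp only [← hker, Finset.mul_sum, Finset.sum_mul]
      rw [Finset.sum_comm]
      refine Finset.sum_congr rfl fun k _ => Finset.sum_congr rfl fun α _ => ?_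
      ring
    rw [hrw, norm_mul, norm_pow, norm_inv, Complex.norm_natCast]
    calc _ ≤ (N : ℝ)⁻¹ ^ n * ∑ k ∈ G, ‖y‖ *
          ∏ j : Fin n, ‖dirichletKer m (-(Real.log (Nat.nth Nat.Prime (j : ℕ)) * t)
          + k j * (2 * Real.pi / N))‖ := by
          gcongr
          refine (norm_sum_le _ _).trans (Finset.sum_le_sum fun k _ => ?_)
          rw [norm_mul, norm_prod]
          gcongr
          exact ((φ k).le_opNorm y).trans (mul_le_of_le_one_left (norm_nonneg _) (hφ1 k))
      -- The sum over the grid of a product over coordinates factorizes; each factor is a Riemann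
      -- sum with its own offset, to which `hB` applies.
      _ = (∏ j : Fin n, (N : ℝ)⁻¹ * ∑ k ∈ Finset.range N,
          ‖dirichletKer m (-(Real.log (Nat.nth Nat.Prime (j : ℕ)) * t)
          + k * (2 * Real.pi / N))‖) * ‖y‖ := by
          rw [← Finset.mul_sum, Finset.prod_mul_distrib, Finset.prod_const, Finset.card_univ,
            Fintype.card_fin, ← Finset.sum_prod_piFinset (Finset.range N) (fun (j : Fin n) k =>
              ‖dirichletKer m (-(Real.log (Nat.nth Nat.Prime (j : ℕ)) * t)
                + k * (2 * Real.pi / N))‖)]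
          ring
      _ ≤ _ := by
          gcongr
          refine (Finset.prod_le_prod (fun j _ => mul_nonneg (by positivity)
            (Finset.sum_nonneg fun _ _ => norm_nonneg _)) fun j _ => hB _).trans ?_
          simp
  refine ⟨I.equivRange.toLinearIsometry.toContinuousLinearMap.comp Q, ?_, ?_⟩
  · rintro ⟨_, D, rfl⟩
    refine Subtype.ext ?_
    change I (Q (I D)) = I D
    rw [hQI]
  · refine ContinuousLinearMap.opNorm_le_bound _ (by positivity) fun y => ?_
    refine le_trans (le_of_eq ?_) (hQn y)
    exact I.equivRange.norm_map (Q y)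

end HInf

theorem projConst_HInf_le (m n : ℕ) :
    projConst (HInf logFreq (NInf m n)) ≤ ENNReal.ofReal (lebesgueConst m ^ n) := by
  refine iSup_le fun Y => iSup_le fun _ => iSup_le fun _ => iSup_le fun _ => iSup_le fun I =>
    iSup_le fun _ => ?_
  have hlim : Tendsto (fun ε : ℝ => ENNReal.ofReal ((lebesgueConst m + ε) ^ n)) (𝓝[>] 0)
      (𝓝 (ENNReal.ofReal (lebesgueConst m ^ n))) := by
    have : Continuous fun ε : ℝ => ENNReal.ofReal ((lebesgueConst m + ε) ^ n) :=
      ENNReal.continuous_ofReal.comp (by fun_prop)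
    simpa using (this.tendsto 0).mono_left nhdsWithin_le_nhds
  refine ge_of_tendsto hlim ?_
  filter_upwards [self_mem_nhdsWithin] with ε hε
  obtain ⟨N, hN, hB⟩ := exists_riemannSum_dirichletKer_le m hε
  obtain ⟨P, hP, hPn⟩ := HInf.exists_projection_norm_le I hN hB
  refine (iInf₂_le P hP).trans ?_
  rw [← ofReal_norm]
  exact ENNReal.ofReal_le_ofReal hPn

/-! ### Trigonometric polynomials nearly attaining the Lebesgue constant -/

theorem integral_exp_zpow (k : ℤ) :
    ∫ θ in (0 : ℝ)..(2 * Real.pi), Complex.exp ((θ : ℂ) * Complex.I) ^ k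
      = if k = 0 then ((2 * Real.pi : ℝ) : ℂ) else 0 := by
  split_ifs with h
  · subst h
    simp
  · have hc : (k : ℂ) * Complex.I ≠ 0 := by simp [h]
    have h1 : ∀ θ : ℝ, Complex.exp ((θ : ℂ) * Complex.I) ^ k
        = Complex.exp ((k : ℂ) * Complex.I * θ) := by
      intro θ
      rw [← Complex.exp_int_mul]
      ring_nf
    simp only [h1]
    rw [integral_exp_mul_complex hc]
    have : (k : ℂ) * Complex.I * ((2 * Real.pi : ℝ) : ℂ) = k * (2 * Real.pi * Complex.I) := by
      push_cast
      ring
    rw [this, Complex.exp_int_mul_two_pi_mul_I]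
    simp

/-- By orthogonality, pairing with the kernel gives the value at `0` of the Fourier projection onto
the frequencies `0, …, m`. -/
theorem integral_trigPoly_mul_conj_dirichletKer (m : ℕ) (S : Finset ℤ) (b : ℤ → ℂ) :
    ∫ θ in (0 : ℝ)..(2 * Real.pi), (∑ k ∈ S, b k * Complex.exp ((θ : ℂ) * Complex.I) ^ k) *
        starRingEnd ℂ (dirichletKer m θ)
      = ((2 * Real.pi : ℝ) : ℂ) * ∑ k ∈ S, if 0 ≤ k ∧ k ≤ m then b k else 0 := by
  have hcont : ∀ k : ℤ, Continuous fun θ : ℝ => Complex.exp ((θ : ℂ) * Complex.I) ^ k := by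
    intro k
    simp only [← Complex.exp_int_mul]
    fun_prop
  have h1 : ∀ θ : ℝ, (∑ k ∈ S, b k * Complex.exp ((θ : ℂ) * Complex.I) ^ k) *
      starRingEnd ℂ (dirichletKer m θ) = ∑ k ∈ S, ∑ l ∈ Finset.range (m + 1),
        b k * Complex.exp ((θ : ℂ) * Complex.I) ^ (k - (l : ℤ)) := by
    intro θ
    rw [dirichletKer, map_sum, Finset.sum_mul_sum]
    refine Finset.sum_congr rfl fun k _ => Finset.sum_congr rfl fun l _ => ?_
    rw [zpow_sub₀ (Complex.exp_ne_zero _), map_pow, ← Complex.exp_conj, zpow_natCast, mul_assoc,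
      div_eq_mul_inv, ← inv_pow, ← Complex.exp_neg]
    simp
  have hterm : ∀ (k : ℤ) (l : ℕ), Continuous fun θ : ℝ =>
      b k * Complex.exp ((θ : ℂ) * Complex.I) ^ (k - (l : ℤ)) :=
    fun k l => continuous_const.mul (hcont _)
  have hsum : ∀ k : ℤ, Continuous fun θ : ℝ => ∑ l ∈ Finset.range (m + 1),
      b k * Complex.exp ((θ : ℂ) * Complex.I) ^ (k - (l : ℤ)) :=
    fun k => continuous_finsetSum _ fun l _ => hterm k l
  simp only [h1]
  rw [intervalIntegral.integral_finsetSum fun k _ => (hsum k).intervalIntegrable _ _,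
    Finset.mul_sum]
  refine Finset.sum_congr rfl fun k _ => ?_
  rw [intervalIntegral.integral_finsetSum fun l _ => (hterm k l).intervalIntegrable _ _]
  simp only [intervalIntegral.integral_const_mul, integral_exp_zpow]
  split_ifs with h
  · rw [Finset.sum_eq_single k.toNat]
    · rw [if_pos (by omega)]
      ring
    · intro l _ hl
      rw [if_neg (by omega), mul_zero]
    · intro hk
      exact absurd (Finset.mem_range.2 (by omega)) hk
  · rw [mul_zero]
    refine Finset.sum_eq_zero fun l hl => ?_
    have := Finset.mem_range.1 hl
    rw [if_neg (by omega), mul_zero]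

/-- The ideal test function is the sign of the kernel `D`. Its continuous substitute `D / (|D| + δ)`
loses at most `δ`, since `|D|² / (|D| + δ) ≥ |D| - δ`. Uniform approximation within `δ` by a
trigonometric polynomial loses a further `δ * lebesgueConst m`. -/
theorem exists_trigPoly_approx (m : ℕ) {δ : ℝ} (hδ : 0 < δ) :
    ∃ (S : Finset ℤ) (b : ℤ → ℂ),
      (∀ θ : ℝ, ‖∑ k ∈ S, b k * Complex.exp ((θ : ℂ) * Complex.I) ^ k‖ ≤ 1 + δ) ∧
      lebesgueConst m - δ - δ * lebesgueConst m
        ≤ ‖∑ k ∈ S, if 0 ≤ k ∧ k ≤ m then b k else 0‖ := by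
  have : Fact (0 < 2 * Real.pi) := ⟨Real.two_pi_pos⟩
  let Dc : C(AddCircle (2 * Real.pi), ℂ) := ∑ k ∈ Finset.range (m + 1), fourier (k : ℤ)
  have hfour : ∀ (k : ℤ) (θ : ℝ), fourier k (θ : AddCircle (2 * Real.pi))
      = Complex.exp ((θ : ℂ) * Complex.I) ^ k := by
    intro k θ
    rw [fourier_coe_apply, ← Complex.exp_int_mul]
    congr 1
    have : (Real.pi : ℂ) ≠ 0 := by exact_mod_cast Real.pi_ne_zero
    push_cast
    field_simp
  have hDc : ∀ θ : ℝ, Dc (θ : AddCircle (2 * Real.pi)) = dirichletKer m θ := by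
    intro θ
    simp only [Dc, ContinuousMap.coe_sum, Finset.sum_apply, hfour, dirichletKer, zpow_natCast]
  have hpos : ∀ x, 0 < ‖Dc x‖ + δ := fun x => by positivity
  let G0 : C(AddCircle (2 * Real.pi), ℂ) :=
    ⟨fun x => Dc x / ((‖Dc x‖ + δ : ℝ) : ℂ), by
      refine Dc.continuous.div ?_ fun x => by exact_mod_cast (hpos x).ne'
      exact Complex.continuous_ofReal.comp (Dc.continuous.norm.add continuous_const)⟩
  have hG0 : G0 ∈ (Submodule.span ℂ
      (Set.range (@fourier (2 * Real.pi)))).topologicalClosure := by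
    rw [span_fourier_closure_eq_top]
    trivial
  obtain ⟨G, hG, hdist⟩ := Metric.mem_closure_iff.1 hG0 δ hδ
  obtain ⟨b, hb⟩ := Finsupp.mem_span_range_iff_exists_finsupp.1 hG
  have hGval : ∀ θ : ℝ, G (θ : AddCircle (2 * Real.pi))
      = ∑ k ∈ b.support, b k * Complex.exp ((θ : ℂ) * Complex.I) ^ k := by
    intro θ
    rw [← hb, Finsupp.sum, ContinuousMap.coe_sum, Finset.sum_apply]
    simp [hfour]
  have hclose : ∀ x, ‖G x - G0 x‖ ≤ δ := by
    intro x
    rw [← dist_eq_norm, dist_comm]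
    exact (ContinuousMap.dist_apply_le_dist x).trans hdist.le
  have hG0le : ∀ x, ‖G0 x‖ ≤ 1 := by
    intro x
    change ‖Dc x / ((‖Dc x‖ + δ : ℝ) : ℂ)‖ ≤ 1
    rw [norm_div, Complex.norm_real, Real.norm_of_nonneg (hpos x).le, div_le_one (hpos x)]
    linarith
  refine ⟨b.support, b, fun θ => ?_, ?_⟩
  · rw [← hGval]
    calc _ = ‖G0 (θ : AddCircle (2 * Real.pi)) + (G θ - G0 θ)‖ := by rw [add_sub_cancel]
      _ ≤ _ := (norm_add_le _ _).trans (add_le_add (hG0le _) (hclose _))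
  · set s := ∑ k ∈ b.support, if 0 ≤ k ∧ k ≤ m then b k else 0 with hs
    have hint := integral_trigPoly_mul_conj_dirichletKer m b.support b
    simp only [← hGval] at hint
    have hcD : Continuous fun θ : ℝ => starRingEnd ℂ (dirichletKer m θ) :=
      Complex.continuous_conj.comp (continuous_dirichletKer m)
    have hcG : ∀ F : C(AddCircle (2 * Real.pi), ℂ),
        Continuous fun θ : ℝ => F (θ : AddCircle (2 * Real.pi)) :=
      fun F => F.continuous.comp (AddCircle.continuous_mk' _)
    have hsplit : ∫ θ in (0 : ℝ)..(2 * Real.pi), G θ * starRingEnd ℂ (dirichletKer m θ)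
        = (∫ θ in (0 : ℝ)..(2 * Real.pi), G0 θ * starRingEnd ℂ (dirichletKer m θ))
          + ∫ θ in (0 : ℝ)..(2 * Real.pi), (G θ - G0 θ) * starRingEnd ℂ (dirichletKer m θ) := by
      refine Eq.trans ?_ (intervalIntegral.integral_add
        (((hcG G0).mul hcD).intervalIntegrable _ _)
        ((((hcG G).sub (hcG G0)).mul hcD).intervalIntegrable _ _))
      refine intervalIntegral.integral_congr fun θ _ => ?_
      ring
    have hL : ∫ θ in (0 : ℝ)..(2 * Real.pi), ‖dirichletKer m θ‖
        = 2 * Real.pi * lebesgueConst m := by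
      rw [lebesgueConst, ← mul_assoc, mul_inv_cancel₀ Real.two_pi_pos.ne', one_mul]
    have herr : ‖∫ θ in (0 : ℝ)..(2 * Real.pi),
        (G θ - G0 θ) * starRingEnd ℂ (dirichletKer m θ)‖
        ≤ δ * (2 * Real.pi * lebesgueConst m) := by
      rw [← hL, ← intervalIntegral.integral_const_mul]
      refine intervalIntegral.norm_integral_le_of_norm_le Real.two_pi_pos.le
        (Eventually.of_forall fun θ _ => ?_)
        ((continuous_const.mul (continuous_dirichletKer m).norm).intervalIntegrable _ _)
      rw [norm_mul, RCLike.norm_conj]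
      exact mul_le_mul_of_nonneg_right (hclose _) (norm_nonneg _)
    have hmain : 2 * Real.pi * lebesgueConst m - 2 * Real.pi * δ
        ≤ (∫ θ in (0 : ℝ)..(2 * Real.pi), G0 θ * starRingEnd ℂ (dirichletKer m θ)).re := by
      have hre : (∫ θ in (0 : ℝ)..(2 * Real.pi), G0 θ * starRingEnd ℂ (dirichletKer m θ)).re
          = ∫ θ in (0 : ℝ)..(2 * Real.pi), (G0 θ * starRingEnd ℂ (dirichletKer m θ)).re :=
        (Complex.reCLM.intervalIntegral_comp_comm
          (((hcG G0).mul hcD).intervalIntegrable _ _)).symm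
      have hc : 2 * Real.pi * δ = ∫ θ in (0 : ℝ)..(2 * Real.pi), δ := by simp
      rw [hre, ← hL, hc, ← intervalIntegral.integral_sub
        ((continuous_dirichletKer m).norm.intervalIntegrable _ _) (by simp)]
      refine intervalIntegral.integral_mono_on Real.two_pi_pos.le
        (((continuous_dirichletKer m).norm.sub continuous_const).intervalIntegrable _ _)
        ((Complex.continuous_re.comp ((hcG G0).mul hcD)).intervalIntegrable _ _) fun θ _ => ?_
      have hval : G0 (θ : AddCircle (2 * Real.pi)) * starRingEnd ℂ (dirichletKer m θ)
          = ((‖dirichletKer m θ‖ ^ 2 / (‖dirichletKer m θ‖ + δ) : ℝ) : ℂ) := by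
        change Dc (θ : AddCircle (2 * Real.pi)) / ((‖Dc θ‖ + δ : ℝ) : ℂ) * _ = _
        rw [hDc, div_mul_eq_mul_div, Complex.mul_conj, Complex.normSq_eq_norm_sq]
        push_cast
        rfl
      rw [hval, Complex.ofReal_re, le_div_iff₀ (by positivity)]
      nlinarith [sq_nonneg δ]
    have hfin : 2 * Real.pi * lebesgueConst m - 2 * Real.pi * δ
        - δ * (2 * Real.pi * lebesgueConst m) ≤ 2 * Real.pi * ‖s‖ := by
      have h1 : ‖((2 * Real.pi : ℝ) : ℂ) * s‖ = 2 * Real.pi * ‖s‖ := by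
        rw [norm_mul, Complex.norm_real, Real.norm_of_nonneg Real.two_pi_pos.le]
      rw [← h1, ← hint, hsplit]
      have h2 := Complex.abs_re_le_norm
        (∫ θ in (0 : ℝ)..(2 * Real.pi), G0 θ * starRingEnd ℂ (dirichletKer m θ))
      have h3 := norm_sub_le_norm_add
        (∫ θ in (0 : ℝ)..(2 * Real.pi), G0 θ * starRingEnd ℂ (dirichletKer m θ))
        (∫ θ in (0 : ℝ)..(2 * Real.pi), (G θ - G0 θ) * starRingEnd ℂ (dirichletKer m θ))
      have h4 := le_abs_self (∫ θ in (0 : ℝ)..(2 * Real.pi),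
        G0 θ * starRingEnd ℂ (dirichletKer m θ)).re
      linarith
    have : 2 * Real.pi * (lebesgueConst m - δ - δ * lebesgueConst m) ≤ 2 * Real.pi * ‖s‖ := by
      linarith
    exact le_of_mul_le_mul_left this Real.two_pi_pos

/-! ### The lower bound -/

namespace HInf

variable {m n : ℕ}

/-- The isometric embedding of `H_∞^J(ω)` into the bounded continuous functions on the line. -/
noncomputable def restrictImagIsometry (ω : ℕ → ℝ) (J : Finset ℕ) : HInf ω J →ₗᵢ[ℂ] (ℝ →ᵇ ℂ) where
  toLinearMap := restrictImag
  norm_map' _ := rfl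

/-- Here `D` stands for the image of the character of `κ` under a projection. If `κ` lies in the
box, the product is constantly `1`; otherwise all its frequencies `κ - α` are nonzero and the mean
vanishes, whatever `D` is. -/
theorem lineChar_mul_toFun_neg_hasMean (κ : Fin n → ℤ) (D : HInf logFreq (NInf m n))
    (hD : (∀ j, 0 ≤ κ j ∧ κ j ≤ m) →
      ∀ t : ℝ, D.toFun ((t : ℂ) * Complex.I) = lineChar (primeForm n κ) t) :
    HasMean (fun t : ℝ => lineChar (primeForm n κ) t * D.toFun (((-t : ℝ) : ℂ) * Complex.I))
      (∏ j, if 0 ≤ κ j ∧ κ j ≤ m then 1 else 0) := by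
  by_cases hκ : ∀ j, 0 ≤ κ j ∧ κ j ≤ m
  · convert hasMean_one using 1
    · funext t
      rw [hD hκ, lineChar_neg_right, ← lineChar_add, add_neg_cancel, lineChar_zero]
    · exact Finset.prod_eq_one fun j _ => if_pos (hκ j)
  · obtain ⟨a, rfl⟩ := ofCoeff_surjective D
    have h0 : (∏ j, if 0 ≤ κ j ∧ κ j ≤ m then (1 : ℂ) else 0) = 0 := by
      push Not at hκ
      obtain ⟨j, hj⟩ := hκ
      exact Finset.prod_eq_zero (Finset.mem_univ j) (if_neg fun h => by have := hj h.1; omega)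
    have h1 : HasMean (fun t : ℝ => ∑ α ∈ multiIndexLe m n,
        a α * lineChar (primeForm n (κ - fun j => (α j : ℤ))) t)
        (∑ α ∈ multiIndexLe m n, a α * if κ - (fun j => (α j : ℤ)) = 0 then 1 else 0) :=
      HasMean.sum fun α _ => (hasMean_lineChar_primeForm _).const_mul (a α)
    convert h1 using 1
    · funext t
      rw [ofCoeff_toFun, Finset.mul_sum]
      refine Finset.sum_congr rfl fun α _ => ?_
      rw [indexChar, lineChar_neg_right, map_sub, sub_eq_add_neg, lineChar_add]
      ring
    · rw [h0]
      refine (Finset.sum_eq_zero fun α hα => ?_).symm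
      rw [if_neg, mul_zero]
      intro h
      refine hκ fun j => ?_
      have h2 := congrFun h j
      have h3 := mem_multiIndexLe.1 hα j
      simp only [Pi.sub_apply, Pi.zero_apply] at h2
      omega

/-- Averaging over translations removes all knowledge of `P` except that it fixes the characters of
the box. The average is still bounded by `‖P‖` times the norm of the test function. -/
theorem pow_norm_sum_le_of_projection
    (P : (ℝ →ᵇ ℂ) →L[ℂ] LinearMap.range (restrictImagIsometry logFreq (NInf m n)).toLinearMap)
    (hP : ∀ x : LinearMap.range (restrictImagIsometry logFreq (NInf m n)).toLinearMap,
      P (x : ℝ →ᵇ ℂ) = x) (S : Finset ℤ) (b : ℤ → ℂ) {M : ℝ}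
    (hM : ∀ θ : ℝ, ‖∑ k ∈ S, b k * Complex.exp ((θ : ℂ) * Complex.I) ^ k‖ ≤ M) :
    ‖∑ k ∈ S, if 0 ≤ k ∧ k ≤ m then b k else 0‖ ^ n ≤ ‖P‖ * M ^ n := by
  have hM0 : 0 ≤ M := (norm_nonneg _).trans (hM 0)
  let χ : (Fin n → ℤ) → (ℝ →ᵇ ℂ) := fun κ => BoundedContinuousFunction.ofNormedAddCommGroup
    (lineChar (primeForm n κ)) (continuous_lineChar _) 1 fun t => (norm_lineChar _ t).le
  have hDex : ∀ κ, ∃ D : HInf logFreq (NInf m n), restrictImag D = (P (χ κ) : ℝ →ᵇ ℂ) :=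
    fun κ => (P (χ κ)).2
  choose D hDP using hDex
  have hDval : ∀ κ (t : ℝ), (D κ).toFun ((t : ℂ) * Complex.I) = (P (χ κ) : ℝ →ᵇ ℂ) t :=
    fun κ t => DFunLike.congr_fun (hDP κ) t
  have hfix : ∀ κ : Fin n → ℤ, (∀ j, 0 ≤ κ j ∧ κ j ≤ m) →
      ∀ t : ℝ, (D κ).toFun ((t : ℂ) * Complex.I) = lineChar (primeForm n κ) t := by
    intro κ hκ t
    have hmem : χ κ ∈ LinearMap.range (restrictImagIsometry logFreq (NInf m n)).toLinearMap := by
      refine ⟨ofCoeff m n (Pi.single (fun j => (κ j).toNat) 1), ?_⟩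
      ext t
      change (ofCoeff m n _).toFun ((t : ℂ) * Complex.I) = lineChar (primeForm n κ) t
      rw [ofCoeff_toFun, Finset.sum_eq_single fun j => (κ j).toNat]
      · rw [Pi.single_eq_same, one_mul, indexChar]
        congr 2
        funext j
        have := hκ j
        omega
      · intro α _ hα
        rw [Pi.single_eq_of_ne hα, zero_mul]
      · intro h
        refine absurd (mem_multiIndexLe.2 fun j => ?_) h
        have := hκ j
        omega
    rw [hDval, hP ⟨χ κ, hmem⟩]
    rfl
  let B : Finset (Fin n → ℤ) := Fintype.piFinset fun _ => S
  -- `f t` is the translate by `t` of the product over `j` of the trigonometric polynomial at angle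
  -- `-x log 𝔭_j`.
  let f : ℝ → (ℝ →ᵇ ℂ) := fun t => ∑ κ ∈ B, ((∏ j, b (κ j)) * lineChar (primeForm n κ) t) • χ κ
  have hf : ∀ t, ‖f t‖ ≤ M ^ n := by
    intro t
    refine (BoundedContinuousFunction.norm_le (by positivity)).2 fun x => ?_
    have hval : f t x = ∏ j : Fin n, ∑ k ∈ S, b k * Complex.exp
        (((-(Real.log (Nat.nth Nat.Prime (j : ℕ)) * (t + x)) : ℝ) : ℂ) * Complex.I) ^ k := by
      rw [Finset.prod_univ_sum]
      simp only [f, BoundedContinuousFunction.coe_sum, Finset.sum_apply,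
        BoundedContinuousFunction.coe_smul, smul_eq_mul]
      refine Finset.sum_congr rfl fun κ _ => ?_
      change (∏ j, b (κ j)) * lineChar (primeForm n κ) t * lineChar (primeForm n κ) x = _
      rw [mul_assoc, ← lineChar_add_right, ← prod_lineChar_zpow, ← Finset.prod_mul_distrib]
      refine Finset.prod_congr rfl fun j _ => ?_
      unfold lineChar
      push_cast
      ring_nf
    rw [hval, norm_prod]
    refine (Finset.prod_le_prod (fun j _ => norm_nonneg _) fun j _ => hM _).trans ?_
    simp
  have hmean : HasMean (fun t : ℝ => ∑ κ ∈ B, (∏ j, b (κ j)) *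
      (lineChar (primeForm n κ) t * (D κ).toFun (((-t : ℝ) : ℂ) * Complex.I)))
      (∑ κ ∈ B, (∏ j, b (κ j)) * ∏ j, if 0 ≤ κ j ∧ κ j ≤ m then 1 else 0) :=
    HasMean.sum fun κ _ => (lineChar_mul_toFun_neg_hasMean κ (D κ) (hfix κ)).const_mul _
  have hpow : (∑ κ ∈ B, (∏ j, b (κ j)) * ∏ j, if 0 ≤ κ j ∧ κ j ≤ m then (1 : ℂ) else 0)
      = (∑ k ∈ S, if 0 ≤ k ∧ k ≤ m then b k else 0) ^ n := by
    rw [Finset.sum_pow']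
    refine Finset.sum_congr rfl fun κ _ => ?_
    rw [← Finset.prod_mul_distrib]
    exact Finset.prod_congr rfl fun j _ => by rw [mul_ite, mul_one, mul_zero]
  rw [hpow] at hmean
  rw [← norm_pow]
  refine hmean.norm_le_const fun t => ?_
  -- Translate by `t`, apply `P`, translate back: the value at the origin is `P (f t)` at `-t`.
  have hPf : ∑ κ ∈ B, (∏ j, b (κ j)) *
      (lineChar (primeForm n κ) t * (D κ).toFun (((-t : ℝ) : ℂ) * Complex.I))
      = (P (f t) : ℝ →ᵇ ℂ) (-t) := by
    simp only [f, map_sum, map_smul, Submodule.coe_sum, Submodule.coe_smul,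
      BoundedContinuousFunction.coe_sum, Finset.sum_apply, BoundedContinuousFunction.coe_smul,
      smul_eq_mul]
    exact Finset.sum_congr rfl fun κ _ => by rw [hDval, mul_assoc]
  rw [hPf]
  calc _ ≤ ‖(P (f t) : ℝ →ᵇ ℂ)‖ := BoundedContinuousFunction.norm_coe_le_norm _ _
    _ ≤ ‖P‖ * ‖f t‖ := P.le_opNorm _
    _ ≤ _ := by gcongr; exact hf t

theorem lebesgueConst_pow_le_norm_projection
    (P : (ℝ →ᵇ ℂ) →L[ℂ] LinearMap.range (restrictImagIsometry logFreq (NInf m n)).toLinearMap)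
    (hP : ∀ x : LinearMap.range (restrictImagIsometry logFreq (NInf m n)).toLinearMap,
      P (x : ℝ →ᵇ ℂ) = x) : lebesgueConst m ^ n ≤ ‖P‖ := by
  -- Truncation at `0` keeps the base nonnegative, so that taking `n`-th powers is monotone for
  -- every `δ`.
  have hl : Tendsto (fun δ : ℝ => max (lebesgueConst m - δ - δ * lebesgueConst m) 0 ^ n) (𝓝[>] 0)
      (𝓝 (lebesgueConst m ^ n)) := by
    have : Continuous fun δ : ℝ => max (lebesgueConst m - δ - δ * lebesgueConst m) 0 ^ n := by
      fun_prop
    simpa [lebesgueConst_nonneg] using (this.tendsto 0).mono_left nhdsWithin_le_nhds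
  have hr : Tendsto (fun δ : ℝ => ‖P‖ * (1 + δ) ^ n) (𝓝[>] 0) (𝓝 ‖P‖) := by
    have : Continuous fun δ : ℝ => ‖P‖ * (1 + δ) ^ n := by fun_prop
    simpa using (this.tendsto 0).mono_left nhdsWithin_le_nhds
  refine le_of_tendsto_of_tendsto hl hr ?_
  filter_upwards [self_mem_nhdsWithin] with δ hδ
  obtain ⟨S, b, h1, h2⟩ := exists_trigPoly_approx m hδ
  refine le_trans ?_ (pow_norm_sum_le_of_projection P hP S b h1)
  exact pow_le_pow_left₀ (le_max_right _ _) (max_le h2 (norm_nonneg _)) n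

end HInf

theorem le_projConst_HInf (m n : ℕ) :
    ENNReal.ofReal (lebesgueConst m ^ n) ≤ projConst (HInf logFreq (NInf m n)) := by
  let I := HInf.restrictImagIsometry logFreq (NInf m n)
  -- Only complemented embeddings enter the supremum; the projection built for the upper bound, with
  -- `ε = 1`, shows that this one qualifies.
  have hc : (LinearMap.range I.toLinearMap).ClosedComplemented := by
    obtain ⟨N, hN, hB⟩ := exists_riemannSum_dirichletKer_le m one_pos
    obtain ⟨P, hP, -⟩ := HInf.exists_projection_norm_le I hN hB
    exact ⟨P, hP⟩
  refine le_trans ?_ (le_iSup_of_le (ℝ →ᵇ ℂ) <| le_iSup_of_le inferInstance <|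
    le_iSup_of_le inferInstance <| le_iSup_of_le inferInstance <| le_iSup_of_le I <|
    le_iSup_of_le hc le_rfl)
  refine le_iInf₂ fun P hP => ?_
  rw [← ofReal_norm]
  exact ENNReal.ofReal_le_ofReal (HInf.lebesgueConst_pow_le_norm_projection P hP)

/-- The projection constant of `H_∞^{N_∞(≤m,n)}` is the `n`-th power of a Lebesgue constant. -/
theorem projConst_HInf (m n : ℕ) :
    projConst (HInf logFreq (NInf m n)) = ENNReal.ofReal (lebesgueConst m ^ n) :=
  (projConst_HInf_le m n).antisymm (le_projConst_HInf m n)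

/-! ### Asymptotics of the Lebesgue constants -/

theorem integral_abs_sin_period (a : ℝ) : ∫ x in a..(a + Real.pi), |Real.sin x| = 2 := by
  have hper : Function.Periodic (fun x => |Real.sin x|) Real.pi := fun x => by
    simp only [Real.sin_add_pi, abs_neg]
  rw [hper.intervalIntegral_add_eq a 0, zero_add]
  have : ∫ x in (0 : ℝ)..Real.pi, |Real.sin x| = ∫ x in (0 : ℝ)..Real.pi, Real.sin x := by
    refine intervalIntegral.integral_congr fun x hx => ?_
    rw [Set.uIcc_of_le Real.pi_pos.le] at hx
    exact abs_of_nonneg (Real.sin_nonneg_of_mem_Icc hx)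
  rw [this, integral_sin]
  norm_num

theorem abs_sinc_mul_self {x : ℝ} (hx : 0 ≤ x) : |Real.sinc x| * x = |Real.sin x| := by
  rcases hx.eq_or_lt with rfl | hx
  · simp
  · rw [Real.sinc_of_ne_zero hx.ne', abs_div, abs_of_pos hx, div_mul_cancel₀ _ hx.ne']

theorem continuous_abs_sinc : Continuous fun x : ℝ => |Real.sinc x| := Real.continuous_sinc.abs

theorem integral_abs_sinc_mono {a b : ℝ} (hab : a ≤ b) :
    ∫ x in (0 : ℝ)..a, |Real.sinc x| ≤ ∫ x in (0 : ℝ)..b, |Real.sinc x| := by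
  rw [← intervalIntegral.integral_add_adjacent_intervals
    (continuous_abs_sinc.intervalIntegrable 0 a) (continuous_abs_sinc.intervalIntegrable a b)]
  have := intervalIntegral.integral_nonneg (μ := MeasureTheory.volume)
    (f := fun x => |Real.sinc x|) hab fun _ _ => abs_nonneg _
  linarith

theorem integral_abs_sinc_succ (K : ℕ) :
    ∫ x in (0 : ℝ)..((K + 1 : ℕ) * Real.pi), |Real.sinc x|
      = (∫ x in (0 : ℝ)..(K * Real.pi), |Real.sinc x|)
        + ∫ x in (K * Real.pi : ℝ)..(K * Real.pi + Real.pi), |Real.sinc x| := by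
  rw [intervalIntegral.integral_add_adjacent_intervals
    (continuous_abs_sinc.intervalIntegrable _ _) (continuous_abs_sinc.intervalIntegrable _ _)]
  push_cast
  rw [add_mul, one_mul]

/-- On this interval `x ≤ (K+1)π`, and `|sin|` integrates to `2` over any interval of length `π`. -/
theorem le_integral_abs_sinc_period (K : ℕ) : 2 / Real.pi * ((K : ℝ) + 1)⁻¹
    ≤ ∫ x in (K * Real.pi : ℝ)..(K * Real.pi + Real.pi), |Real.sinc x| := by
  have hπ := Real.pi_pos
  have h : ∫ x in (K * Real.pi : ℝ)..(K * Real.pi + Real.pi),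
      (((K : ℝ) + 1) * Real.pi)⁻¹ * |Real.sin x|
      ≤ ∫ x in (K * Real.pi : ℝ)..(K * Real.pi + Real.pi), |Real.sinc x| := by
    refine intervalIntegral.integral_mono_on (by linarith)
      ((continuous_const.mul Real.continuous_sin.abs).intervalIntegrable _ _)
      (continuous_abs_sinc.intervalIntegrable _ _) fun x hx => ?_
    have hx0 : 0 ≤ x := le_trans (by positivity) hx.1
    rw [inv_mul_le_iff₀ (by positivity), ← abs_sinc_mul_self hx0, mul_comm]
    gcongr
    linarith [hx.2]
  rw [intervalIntegral.integral_const_mul, integral_abs_sin_period] at h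
  refine le_trans (le_of_eq ?_) h
  field_simp

/-- The index is shifted by one to stay away from `0`, so that `x ≥ (K+1)π`; the initial interval is
bounded separately through `|sinc| ≤ 1`. -/
theorem integral_abs_sinc_period_le (K : ℕ) :
    ∫ x in ((K + 1 : ℕ) * Real.pi : ℝ)..((K + 1 : ℕ) * Real.pi + Real.pi), |Real.sinc x|
      ≤ 2 / Real.pi * ((K : ℝ) + 1)⁻¹ := by
  have hπ := Real.pi_pos
  have h : ∫ x in ((K + 1 : ℕ) * Real.pi : ℝ)..((K + 1 : ℕ) * Real.pi + Real.pi), |Real.sinc x|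
      ≤ ∫ x in ((K + 1 : ℕ) * Real.pi : ℝ)..((K + 1 : ℕ) * Real.pi + Real.pi),
        (((K : ℝ) + 1) * Real.pi)⁻¹ * |Real.sin x| := by
    refine intervalIntegral.integral_mono_on (by linarith)
      (continuous_abs_sinc.intervalIntegrable _ _)
      ((continuous_const.mul Real.continuous_sin.abs).intervalIntegrable _ _) fun x hx => ?_
    have hx1 := hx.1
    push_cast at hx1
    have hx0 : 0 ≤ x := le_trans (by positivity) hx1
    rw [le_inv_mul_iff₀ (by positivity), ← abs_sinc_mul_self hx0, mul_comm]
    gcongr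
  rw [intervalIntegral.integral_const_mul, integral_abs_sin_period] at h
  refine h.trans (le_of_eq ?_)
  field_simp

theorem harmonic_le_integral_abs_sinc (K : ℕ) :
    2 / Real.pi * (harmonic K : ℝ) ≤ ∫ x in (0 : ℝ)..(K * Real.pi), |Real.sinc x| := by
  induction K with
  | zero => simp
  | succ K ih =>
    rw [integral_abs_sinc_succ, harmonic_succ]
    push_cast
    rw [mul_add]
    exact add_le_add ih (le_integral_abs_sinc_period K)

theorem integral_abs_sinc_le_harmonic (K : ℕ) :
    ∫ x in (0 : ℝ)..((K + 1 : ℕ) * Real.pi), |Real.sinc x|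
      ≤ Real.pi + 2 / Real.pi * (harmonic K : ℝ) := by
  induction K with
  | zero =>
    have h := intervalIntegral.integral_mono_on (μ := MeasureTheory.volume)
      (g := fun _ => (1 : ℝ)) Real.pi_pos.le (continuous_abs_sinc.intervalIntegrable _ _)
      (by simp) fun x _ => Real.abs_sinc_le_one x
    simpa using h
  | succ K ih =>
    rw [integral_abs_sinc_succ, harmonic_succ]
    push_cast at *
    have := integral_abs_sinc_period_le K
    push_cast at this
    rw [mul_add]
    linarith

/-- Geometric sum together with `|e^{ix} - 1| = 2|sin(x/2)|`; the multiplied form also covers the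
zeros of `sin u`. -/
theorem norm_dirichletKer_mul_abs_sin (m : ℕ) (u : ℝ) :
    ‖dirichletKer m (2 * u)‖ * |Real.sin u| = |Real.sin (((m : ℝ) + 1) * u)| := by
  have h := mul_geom_sum (Complex.exp (((2 * u : ℝ) : ℂ) * Complex.I)) (m + 1)
  rw [← Complex.exp_nat_mul] at h
  have e : ((m + 1 : ℕ) : ℂ) * (((2 * u : ℝ) : ℂ) * Complex.I)
      = Complex.I * ((2 * (((m : ℝ) + 1) * u) : ℝ) : ℂ) := by
    push_cast
    ring
  have h2 := congrArg norm h
  rw [e, norm_mul, mul_comm (((2 * u : ℝ) : ℂ)), Complex.norm_exp_I_mul_ofReal_sub_one,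
    Complex.norm_exp_I_mul_ofReal_sub_one, mul_div_cancel_left₀ _ (two_ne_zero),
    mul_div_cancel_left₀ _ (two_ne_zero), norm_mul, norm_mul, Real.norm_eq_abs, Real.norm_eq_abs,
    mul_comm Complex.I] at h2
  rw [abs_two, Real.norm_eq_abs] at h2
  unfold dirichletKer
  linarith

theorem norm_dirichletKer_neg (m : ℕ) (θ : ℝ) : ‖dirichletKer m (-θ)‖ = ‖dirichletKer m θ‖ := by
  rw [← RCLike.norm_conj (dirichletKer m θ)]
  congr 1
  unfold dirichletKer
  rw [map_sum]
  refine Finset.sum_congr rfl fun k _ => ?_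
  rw [map_pow, ← Complex.exp_conj]
  simp

/-- Periodicity, evenness and `θ = 2u` move the integral to `[0, π/2]`, where `sin u` is comparable
to `u`. -/
theorem lebesgueConst_eq (m : ℕ) : lebesgueConst m
    = 2 / Real.pi * ∫ u in (0 : ℝ)..(Real.pi / 2), ‖dirichletKer m (2 * u)‖ := by
  have hc := (continuous_dirichletKer m).norm
  have hper : Function.Periodic (fun θ => ‖dirichletKer m θ‖) (2 * Real.pi) := fun θ => by
    simp only [periodic_dirichletKer m θ]
  have h1 : ∫ θ in (0 : ℝ)..(2 * Real.pi), ‖dirichletKer m θ‖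
      = ∫ θ in (-Real.pi)..Real.pi, ‖dirichletKer m θ‖ := by
    have := hper.intervalIntegral_add_eq 0 (-Real.pi)
    rwa [zero_add, show -Real.pi + 2 * Real.pi = Real.pi by ring] at this
  have h2 : ∫ θ in (-Real.pi)..(0 : ℝ), ‖dirichletKer m θ‖
      = ∫ θ in (0 : ℝ)..Real.pi, ‖dirichletKer m θ‖ := by
    have := intervalIntegral.integral_comp_neg (a := 0) (b := Real.pi)
      (fun θ => ‖dirichletKer m θ‖)
    simp only [norm_dirichletKer_neg, neg_zero] at this
    exact this.symm
  have h3 := intervalIntegral.mul_integral_comp_mul_left (a := 0) (b := Real.pi / 2)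
    (f := fun θ => ‖dirichletKer m θ‖) (2 : ℝ)
  rw [mul_zero, show 2 * (Real.pi / 2) = Real.pi by ring] at h3
  rw [lebesgueConst, h1, ← intervalIntegral.integral_add_adjacent_intervals
    (hc.intervalIntegrable (-Real.pi) 0) (hc.intervalIntegrable 0 Real.pi), h2, ← h3]
  have := Real.pi_ne_zero
  field_simp
  ring

theorem dirichletKer_zero (m : ℕ) : dirichletKer m 0 = (m : ℂ) + 1 := by
  simp [dirichletKer]

theorem sinc_le_norm_dirichletKer (m : ℕ) {u : ℝ} (h0 : 0 ≤ u) (h1 : u ≤ Real.pi / 2) :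
    ((m : ℝ) + 1) * |Real.sinc (((m : ℝ) + 1) * u)| ≤ ‖dirichletKer m (2 * u)‖ := by
  rcases h0.eq_or_lt with rfl | h0
  · rw [mul_zero, mul_zero, dirichletKer_zero, Real.sinc_zero, abs_one, mul_one,
      ← Complex.ofReal_natCast, ← Complex.ofReal_one, ← Complex.ofReal_add, Complex.norm_real]
    exact le_abs_self _
  · refine le_of_mul_le_mul_right ?_ h0
    have hs := norm_dirichletKer_mul_abs_sin m u
    have hk := abs_sinc_mul_self (x := ((m : ℝ) + 1) * u) (by positivity)
    have hsin : |Real.sin u| ≤ u := by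
      rw [abs_of_nonneg (Real.sin_nonneg_of_nonneg_of_le_pi h0.le (by linarith))]
      exact Real.sin_le h0.le
    calc _ = |Real.sinc (((m : ℝ) + 1) * u)| * (((m : ℝ) + 1) * u) := by ring
      _ = ‖dirichletKer m (2 * u)‖ * |Real.sin u| := by rw [hk, hs]
      _ ≤ _ := by gcongr

/-- Equivalent to `1/sin u ≤ 1/u + 1`, which keeps the error of the sinc comparison bounded. It
combines `u cos u ≤ sin u` with `sin u + cos u ≥ 1`. -/
theorem le_sin_mul_one_add {u : ℝ} (h0 : 0 < u) (h1 : u ≤ Real.pi / 2) :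
    u ≤ Real.sin u * (1 + u) := by
  have hs : 0 < Real.sin u := Real.sin_pos_of_pos_of_lt_pi h0 (by linarith [Real.pi_pos])
  have hc : 0 ≤ Real.cos u := Real.cos_nonneg_of_mem_Icc ⟨by linarith [Real.pi_pos], h1⟩
  have htan : u * Real.cos u ≤ Real.sin u := by
    rcases h1.eq_or_lt with rfl | h1
    · simp
    · have h2 : 0 < Real.cos u := Real.cos_pos_of_mem_Ioo ⟨by linarith [Real.pi_pos], h1⟩
      have := Real.lt_tan h0 h1
      rw [Real.tan_eq_sin_div_cos, lt_div_iff₀ h2] at this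
      exact this.le
  have hsc : 1 ≤ Real.sin u + Real.cos u := by
    nlinarith [Real.sin_sq_add_cos_sq u, mul_nonneg hs.le hc]
  nlinarith

theorem norm_dirichletKer_le_sinc (m : ℕ) {u : ℝ} (h0 : 0 ≤ u) (h1 : u ≤ Real.pi / 2) :
    ‖dirichletKer m (2 * u)‖ ≤ ((m : ℝ) + 1) * |Real.sinc (((m : ℝ) + 1) * u)| + 1 := by
  rcases h0.eq_or_lt with rfl | h0
  · rw [mul_zero, mul_zero, dirichletKer_zero, Real.sinc_zero, abs_one, mul_one]
    have : ‖(m : ℂ) + 1‖ ≤ (m : ℝ) + 1 := (norm_add_le _ _).trans (by simp)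
    linarith
  · have hs := norm_dirichletKer_mul_abs_sin m u
    have hk := abs_sinc_mul_self (x := ((m : ℝ) + 1) * u) (by positivity)
    have hsin : 0 < Real.sin u := Real.sin_pos_of_pos_of_lt_pi h0 (by linarith [Real.pi_pos])
    rw [abs_of_pos hsin] at hs
    refine le_of_mul_le_mul_right ?_ h0
    calc _ ≤ ‖dirichletKer m (2 * u)‖ * (Real.sin u * (1 + u)) := by
          gcongr
          exact le_sin_mul_one_add h0 h1
      _ = |Real.sin (((m : ℝ) + 1) * u)| + |Real.sin (((m : ℝ) + 1) * u)| * u := by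
          rw [← hs]
          ring
      _ ≤ |Real.sin (((m : ℝ) + 1) * u)| + 1 * u := by
          gcongr
          exact Real.abs_sin_le_one _
      _ = _ := by
          rw [← hk]
          ring

theorem integral_scaled_sinc (m : ℕ) :
    ∫ u in (0 : ℝ)..(Real.pi / 2), ((m : ℝ) + 1) * |Real.sinc (((m : ℝ) + 1) * u)|
      = ∫ x in (0 : ℝ)..(((m : ℝ) + 1) * (Real.pi / 2)), |Real.sinc x| := by
  have := intervalIntegral.mul_integral_comp_mul_left (a := 0) (b := Real.pi / 2)
    (f := fun x => |Real.sinc x|) ((m : ℝ) + 1)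
  rw [mul_zero] at this
  rw [intervalIntegral.integral_const_mul, this]

theorem log_le_lebesgueConst (m : ℕ) :
    4 / Real.pi ^ 2 * Real.log (((m + 1) / 2 : ℕ) + 1) ≤ lebesgueConst m := by
  have hπ := Real.pi_pos
  have hc : Continuous fun u : ℝ => ((m : ℝ) + 1) * |Real.sinc (((m : ℝ) + 1) * u)| :=
    continuous_const.mul (continuous_abs_sinc.comp (continuous_const.mul continuous_id))
  have hc' : Continuous fun u : ℝ => ‖dirichletKer m (2 * u)‖ :=
    (continuous_dirichletKer m).norm.comp (continuous_const.mul continuous_id)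
  have h1 := intervalIntegral.integral_mono_on (μ := MeasureTheory.volume)
    (by positivity : (0 : ℝ) ≤ Real.pi / 2)
    (hc.intervalIntegrable _ _) (hc'.intervalIntegrable _ _)
    fun u hu => sinc_le_norm_dirichletKer m hu.1 hu.2
  rw [integral_scaled_sinc] at h1
  -- The number of complete intervals of length `π` inside `[0, (m+1)π/2]`.
  set K : ℕ := (m + 1) / 2 with hK
  have hKm : (K : ℝ) * 2 ≤ m + 1 := by exact_mod_cast (by omega : K * 2 ≤ m + 1)
  have h2 := integral_abs_sinc_mono (a := K * Real.pi) (b := ((m : ℝ) + 1) * (Real.pi / 2))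
    (by nlinarith)
  have h3 := harmonic_le_integral_abs_sinc K
  have h4 : Real.log ((K : ℝ) + 1) ≤ (harmonic K : ℝ) := by
    have := log_add_one_le_harmonic K
    push_cast at this
    exact this
  rw [lebesgueConst_eq]
  calc _ = 2 / Real.pi * (2 / Real.pi * Real.log ((K : ℝ) + 1)) := by
        field_simp
        ring
    _ ≤ 2 / Real.pi * (2 / Real.pi * (harmonic K : ℝ)) := by gcongr
    _ ≤ _ := by
        gcongr
        exact h3.trans (h2.trans h1)

theorem lebesgueConst_le_log (m : ℕ) :
    lebesgueConst m ≤ 4 / Real.pi ^ 2 * Real.log m + 4 := by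
  have hπ := Real.pi_pos
  have hc : Continuous fun u : ℝ => ((m : ℝ) + 1) * |Real.sinc (((m : ℝ) + 1) * u)| :=
    continuous_const.mul (continuous_abs_sinc.comp (continuous_const.mul continuous_id))
  have hc' : Continuous fun u : ℝ => ‖dirichletKer m (2 * u)‖ :=
    (continuous_dirichletKer m).norm.comp (continuous_const.mul continuous_id)
  have h1 := intervalIntegral.integral_mono_on (μ := MeasureTheory.volume)
    (g := fun u : ℝ => ((m : ℝ) + 1) * |Real.sinc (((m : ℝ) + 1) * u)| + 1)
    (by positivity : (0 : ℝ) ≤ Real.pi / 2)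
    (hc'.intervalIntegrable _ _) ((hc.intervalIntegrable _ _).add (by simp))
    fun u hu => norm_dirichletKer_le_sinc m hu.1 hu.2
  rw [intervalIntegral.integral_add (hc.intervalIntegrable _ _) (by simp), integral_scaled_sinc]
    at h1
  -- Doubling the range of integration affects only the additive constant, because the growth is
  -- logarithmic.
  have h2 := integral_abs_sinc_mono (a := ((m : ℝ) + 1) * (Real.pi / 2))
    (b := (m + 1 : ℕ) * Real.pi) (by push_cast; nlinarith)
  have h3 := integral_abs_sinc_le_harmonic m
  have h4 := harmonic_le_one_add_log m
  have h5 : ∫ _ in (0 : ℝ)..(Real.pi / 2), (1 : ℝ) = Real.pi / 2 := by simp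
  rw [h5] at h1
  have h6 : 4 / Real.pi ^ 2 ≤ 1 := by
    rw [div_le_one (by positivity)]
    nlinarith [Real.pi_gt_three]
  rw [lebesgueConst_eq]
  calc _ ≤ 2 / Real.pi * (Real.pi + 2 / Real.pi * (1 + Real.log m) + Real.pi / 2) := by
        gcongr
        have : 2 / Real.pi * (harmonic m : ℝ) ≤ 2 / Real.pi * (1 + Real.log m) := by gcongr
        linarith
    _ = 3 + 4 / Real.pi ^ 2 + 4 / Real.pi ^ 2 * Real.log m := by
        field_simp
        ring
    _ ≤ _ := by linarith

theorem log_sub_le_lebesgueConst {m : ℕ} (hm : 1 ≤ m) :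
    4 / Real.pi ^ 2 * Real.log m - 4 ≤ lebesgueConst m := by
  have h := log_le_lebesgueConst m
  have hm' : (1 : ℝ) ≤ m := by exact_mod_cast hm
  have hK : (m : ℝ) / 2 ≤ ((m + 1) / 2 : ℕ) + 1 := by
    rw [div_le_iff₀ two_pos]
    exact_mod_cast (by omega : m ≤ ((m + 1) / 2 + 1) * 2)
  have h1 := Real.log_le_log (by positivity) hK
  rw [Real.log_div (by positivity) two_ne_zero] at h1
  have h6 : 4 / Real.pi ^ 2 ≤ 1 := by
    rw [div_le_one (by positivity)]
    nlinarith [Real.pi_gt_three]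
  have h0 : 0 ≤ 4 / Real.pi ^ 2 := by positivity
  have h2 := mul_le_mul_of_nonneg_left h1 h0
  nlinarith [Real.log_two_lt_d9, Real.log_two_gt_d9]

theorem one_add_log_le_lebesgueConst {m : ℕ} (hm : 1 ≤ m) :
    1 + Real.log m ≤ 10 * lebesgueConst m := by
  have h := log_le_lebesgueConst m
  have hm' : (1 : ℝ) ≤ m := by exact_mod_cast hm
  set K : ℕ := (m + 1) / 2 with hKdef
  have hK : (m : ℝ) / 2 ≤ (K : ℝ) + 1 := by
    rw [div_le_iff₀ two_pos]
    exact_mod_cast (by omega : m ≤ (K + 1) * 2)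
  have h1 := Real.log_le_log (by positivity) hK
  rw [Real.log_div (by positivity) two_ne_zero] at h1
  have hK2 : (2 : ℝ) ≤ (K : ℝ) + 1 := by exact_mod_cast (by omega : 2 ≤ K + 1)
  have h2 := Real.log_le_log two_pos hK2
  have h3 : 2 / 5 ≤ 4 / Real.pi ^ 2 := by
    rw [div_le_div_iff₀ (by norm_num) (by positivity)]
    nlinarith [Real.pi_lt_d2, Real.pi_pos]
  have h4 := mul_le_mul_of_nonneg_right h3 (by linarith [Real.log_two_gt_d9] :
    0 ≤ Real.log ((K : ℝ) + 1))
  -- Ten times `2/5` gives four copies of `log (K+1)`: one is at least `log m - log 2`, the others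
  -- are at least `log 2` each, and the surplus `2 log 2` exceeds `1`.
  linarith [Real.log_two_gt_d9]

theorem tendsto_lebesgueConst_div_log :
    Tendsto (fun m : ℕ => lebesgueConst m / Real.log m) atTop (𝓝 (4 / Real.pi ^ 2)) := by
  have hlog : Tendsto (fun m : ℕ => Real.log m) atTop atTop :=
    Real.tendsto_log_atTop.comp tendsto_natCast_atTop_atTop
  rw [tendsto_iff_norm_sub_tendsto_zero]
  refine squeeze_zero' (Eventually.of_forall fun _ => norm_nonneg _) ?_
    (hlog.const_div_atTop 4)
  filter_upwards [hlog.eventually_gt_atTop 0, eventually_ge_atTop 1] with m hm hm1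
  rw [Real.norm_eq_abs, div_sub' hm.ne', abs_div, abs_of_pos hm]
  gcongr
  rw [abs_le]
  constructor <;> linarith [lebesgueConst_le_log m, log_sub_le_lebesgueConst hm1]

theorem theorem2p10 :
    (∃ C : ℝ, 0 < C ∧ ∀ m n : ℕ, 1 ≤ m → 1 ≤ n →
      projConst (HInf logFreq (NInf m n)) ≠ ∞ ∧
      (projConst (HInf logFreq (NInf m n))).toReal ≤ C ^ n * (1 + Real.log m) ^ n ∧
      (1 + Real.log m) ^ n ≤ C ^ n * (projConst (HInf logFreq (NInf m n))).toReal) ∧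
    (∀ n : ℕ, 1 ≤ n →
      Tendsto (fun m : ℕ => (projConst (HInf logFreq (NInf m n))).toReal / Real.log m ^ n)
        atTop (𝓝 ((4 / Real.pi ^ 2) ^ n))) := by
  have hreal : ∀ m n : ℕ, (projConst (HInf logFreq (NInf m n))).toReal = lebesgueConst m ^ n :=
    fun m n => by
      rw [projConst_HInf, ENNReal.toReal_ofReal (pow_nonneg (lebesgueConst_nonneg m) n)]
  -- The value `10` is forced by the argument for the lower estimate; the upper one holds with room
  -- to spare.
  refine ⟨⟨10, by norm_num, fun m n hm _ => ⟨?_, ?_, ?_⟩⟩, fun n _ => ?_⟩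
  · rw [projConst_HInf]
    exact ENNReal.ofReal_ne_top
  · rw [hreal, ← mul_pow]
    refine pow_le_pow_left₀ (lebesgueConst_nonneg m) ?_ n
    have hlog : 0 ≤ Real.log m := Real.log_natCast_nonneg m
    have hπ : 4 / Real.pi ^ 2 ≤ 1 := by
      rw [div_le_one (by positivity)]
      nlinarith [Real.pi_gt_three]
    have := mul_le_mul_of_nonneg_right hπ hlog
    linarith [lebesgueConst_le_log m]
  · rw [hreal, ← mul_pow]
    exact pow_le_pow_left₀ (by linarith [Real.log_natCast_nonneg m])
      (one_add_log_le_lebesgueConst hm) n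
  · simp only [hreal, ← div_pow]
    exact tendsto_lebesgueConst_div_log.pow n
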